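/- Let $-\infty\le a<b\le\infty$ and let $w\ge 0$ be a weight on $(a,b)$, not identically zero, such that all moments $\int_a^b x^j w(x)\,dx$ ($j=0,1,2,\dots$) exist, $\sqrt{w}$ is differentiable on $(a,b)$, and $w$ vanishes at the endpoints: $w(x)\to 0$ as $x\to a^+$ and as $x\to b^-$. Let $N\ge 0$ be an integer, let $\pi_j$ be any real polynomial of degree exactly $j$ ($0\le j\le 2N-1$), put $\psi_j=\pi_j\sqrt{w}$, and suppose that each derivative $\psi_j'$ is integrable on $(a,b)$. Let $f:\mathbb{R}\to\mathbb{C}$ be a Schwartz function and let $$ G_N^{(4)}(f)=\frac{\int_{[a,b]^N}\prod_{1\le j<k\le N}(x_j-x_k)^4\prod_{j=1}^N w(x_j)\,[1+f(x_j)]\,dx_j}{\int_{[a,b]^N}\prod_{1\le j<k\le N}(x_j-x_k)^4\prod_{j=1}^N w(x_j)\,dx_j} $$ be the moment generating function of the symplectic ($\beta=4$) ensemble with weight $w$. Then both integrals converge absolutely, the denominator is positive, the matrix $$ M^{(4)}=\left(\int_a^b\big(\psi_j(x)\psi_k'(x)-\psi_j'(x)\psi_k(x)\big)\,dx\right)_{j,k=0}^{2N-1}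 $$ is well defined and invertible, and, writing $(\mu_{jk})_{j,k=0}^{2N-1}=(M^{(4)})^{-1}$, $$ \left[G_N^{(4)}(f)\right]^2=\det\left(I+2K_{N,4}^{(2,2)}f-K_{N,4}^{(2,2)}\varepsilon f'\right), \qquad K_{N,4}^{(2,2)}(x,y)=-\sum_{j,k=0}^{2N-1}\psi_j(x)\,\mu_{jk}\,\psi_k'(y). $$ Here $K_{N,4}^{(2,2)}$ and $\varepsilon$ are the integral operators on $(a,b)$ with kernels $K_{N,4}^{(2,2)}(x,y)$ and $\varepsilon(x,y)=\tfrac12\,\mathrm{sgn}(x-y)$, $f$ and $f'$ act by multiplication (all the composed kernels being given by absolutely convergent integrals), and the determinant of $I+T$, for an integral operator $T$ with kernel $T(x,y)$, is the Fredholm determinant $$ \det(I+T)=\sum_{n=0}^\infty\frac1{n!}\int_{(a,b)^n}\det\big(T(x_i,x_j)\big)_{i,j=1}^n\,dx_1\cdots dx_n, $$ whose integrals and series converge absolutely. -/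

import Mathlib

open MeasureTheory Filter Topology Polynomial
open scoped SchwartzMap

noncomputable section

namespace SymplecticEnsemble

/-- The real points of the interval with (possibly infinite) endpoints `a` and `b`. The endpoints
themselves are left out; they carry no Lebesgue measure. -/
def interval (a b : EReal) : Set ℝ := {x : ℝ | a < (x : EReal) ∧ (x : EReal) < b}

/-- Lebesgue measure on the interval. -/
def intervalMeasure (a b : EReal) : Measure ℝ := volume.restrict (interval a b)

/-- The unnormalized `β = 4` eigenvalue density `∏_{j<k} (x_j - x_k)^4 ∏_j w(x_j)`. -/
def density (w : ℝ → ℝ) (N : ℕ) (x : Fin N → ℝ) : ℝ :=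
  (∏ j : Fin N, ∏ k ∈ Finset.Ioi j, (x j - x k) ^ 4) * ∏ j : Fin N, w (x j)

/-- The reciprocal `1 / C_N^{(4)}` of the normalization constant. -/
def partitionFunction (a b : EReal) (w : ℝ → ℝ) (N : ℕ) : ℝ :=
  ∫ x : Fin N → ℝ, density w N x ∂(Measure.pi fun _ => intervalMeasure a b)

/-- The density multiplied by `∏_j (1 + f(x_j))`. -/
def deformedDensity (w : ℝ → ℝ) (N : ℕ) (f : ℝ → ℂ) (x : Fin N → ℝ) : ℂ :=
  (density w N x : ℂ) * ∏ j : Fin N, (1 + f (x j))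

/-- The moment generating function `G_N^{(4)}(f)`. -/
def momentGen (a b : EReal) (w : ℝ → ℝ) (N : ℕ) (f : ℝ → ℂ) : ℂ :=
  (∫ x : Fin N → ℝ, deformedDensity w N f x ∂(Measure.pi fun _ => intervalMeasure a b)) /
    (partitionFunction a b w N : ℂ)

/-- `ψ = p √w` for a polynomial `p`. -/
def psi (w : ℝ → ℝ) (p : ℝ[X]) (x : ℝ) : ℝ := p.eval x * √(w x)

/-- The integrand `ψ_j ψ_k' - ψ_j' ψ_k` of the entries of `M^{(4)}`. -/
def momentIntegrand (w : ℝ → ℝ) {n : ℕ} (p : Fin n → ℝ[X]) (j k : Fin n) (x : ℝ) : ℝ :=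
  psi w (p j) x * deriv (psi w (p k)) x - deriv (psi w (p j)) x * psi w (p k) x

/-- The matrix `M^{(4)}`. -/
def momentMatrix (a b : EReal) (w : ℝ → ℝ) {n : ℕ} (p : Fin n → ℝ[X]) :
    Matrix (Fin n) (Fin n) ℝ :=
  Matrix.of fun j k => ∫ x, momentIntegrand w p j k x ∂(intervalMeasure a b)

/-- The kernel `K_{N,4}^{(2,2)}(x,y) = -∑_{j,k} ψ_j(x) μ_{jk} ψ_k'(y)` with
`(μ_{jk}) = (M^{(4)})⁻¹`. -/
def kernel22 (a b : EReal) (w : ℝ → ℝ) {n : ℕ} (p : Fin n → ℝ[X]) (x y : ℝ) : ℝ :=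
  -∑ j : Fin n, ∑ k : Fin n,
    psi w (p j) x * (momentMatrix a b w p)⁻¹ j k * deriv (psi w (p k)) y

/-- The kernel `ε(x,y) = sgn(x - y) / 2`. -/
def epsKernel (x y : ℝ) : ℝ := Real.sign (x - y) / 2

/-- The kernel of the composition `AB` of the integral operators on the interval with
kernels `A` and `B`. -/
def compKernel (a b : EReal) (A B : ℝ → ℝ → ℝ) (x y : ℝ) : ℝ :=
  ∫ t, A x t * B t y ∂(intervalMeasure a b)

/-- The kernel of `A g`: multiplication by the function `g`, followed by the integral operator
with kernel `A`. -/
def mulKernel (A : ℝ → ℝ → ℝ) (g : ℝ → ℂ) (x y : ℝ) : ℂ := (A x y : ℂ) * g y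

/-- The kernel of the scalar integral operator `2 K f - K ε f'` with `K = K_{N,4}^{(2,2)}`. -/
def scalarKernel (a b : EReal) (w : ℝ → ℝ) {n : ℕ} (p : Fin n → ℝ[X]) (f : ℝ → ℂ)
    (x y : ℝ) : ℂ :=
  2 * mulKernel (kernel22 a b w p) f x y -
    mulKernel (compKernel a b (kernel22 a b w p) epsKernel) (deriv f) x y

/-- The determinant `det (T(x_i, x_j))_{i,j < n}`. -/
def kernelMinor (T : ℝ → ℝ → ℂ) (n : ℕ) (x : Fin n → ℝ) : ℂ :=
  (Matrix.of fun i j : Fin n => T (x i) (x j)).det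

/-- `d` is the Fredholm determinant `det(I + T)` of the integral operator on the interval with
kernel `T`: all integrals in the Fredholm series
`∑_n (1/n!) ∫ det (T(x_i, x_j))_{i,j < n} dx_1 ⋯ dx_n` exist, and the series converges
absolutely, with sum `d`. -/
def HasFredholmDet (a b : EReal) (T : ℝ → ℝ → ℂ) (d : ℂ) : Prop :=
  (∀ n : ℕ, Integrable (kernelMinor T n) (Measure.pi fun _ => intervalMeasure a b)) ∧
  HasSum (fun n : ℕ => ((n.factorial : ℂ))⁻¹ *
    ∫ x : Fin n → ℝ, kernelMinor T n x ∂(Measure.pi fun _ => intervalMeasure a b)) d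

end SymplecticEnsemble

end

open SymplecticEnsemble

/-!
Up to sign and leading coefficients, `∏_{j<k} (x_j - x_k)^4 ∏_j w(x_j)` is the determinant with
columns `ψ_r(x_k)` and `ψ_r'(x_k)`: this is the confluent Vandermonde determinant, the terms with
`(√w)'` being removed by column operations. Expanding it and integrating against
`∏_j (1 + f(x_j))` gives, by Fubini, a multiple of the Pfaffian of the matrix
`∫ (ψ_j ψ_k' - ψ_j' ψ_k) (1 + f) = M + F`. The square of a Pfaffian is the determinant, and dividing
by the case `f = 0` leaves `G_N(f)^2 = det (1 + M⁻¹ F)`; positivity of the normalization shows that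
`M` is invertible.

On the operator side `∫ ψ_k'(t) ε(t, y) dt = -ψ_k(y)`, because `ψ_k` vanishes at both ends. At an
infinite end this uses that `ψ_k ^ 2` and its derivative are integrable, since there the decay of
`w` does not control the polynomial factor. So `2 K f - K ε f'` has the finite-rank kernel
`-∑ ψ_j(x) μ_{jk} (2 ψ_k' f + ψ_k f')(y)`, whose Fredholm determinant is that of a matrix of size
`2 N`. Integrating `(ψ_k ψ_l f)'` gives `∫ (2 ψ_k' f + ψ_k f') ψ_l = -F_{kl}`, so this matrix is
`1 + M⁻¹ F` as well.
-/

namespace SymplecticEnsemble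

section Pfaffian

open Equiv Matrix

variable {κ : Type*} [Fintype κ] [DecidableEq κ] {ι : Type*} {R : Type*} [CommRing R]

/-- The polarization of `pfaffianSum`: each pair of indices `(inl k, inr k)` is fed to a matrix of
its own, so that the dependence on each single matrix is linear. -/
def mixedPfaffianSum (A : κ → Matrix (κ ⊕ κ) (κ ⊕ κ) R) : R :=
  ∑ σ : Perm (κ ⊕ κ), ((Perm.sign σ : ℤ) : R) * ∏ k, A k (σ (.inl k)) (σ (.inr k))

/-- The signed sum over all permutations, equal to `2 ^ N * N !` times the Pfaffian when the matrix
is alternating of size `2 N`. Summing over permutations instead of perfect matchings avoids any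
choice of representatives. -/
def pfaffianSum (A : Matrix (κ ⊕ κ) (κ ⊕ κ) R) : R :=
  mixedPfaffianSum fun _ => A

theorem mixedPfaffianSum_update_sub (A : κ → Matrix (κ ⊕ κ) (κ ⊕ κ) R) (k : κ)
    (B C : Matrix (κ ⊕ κ) (κ ⊕ κ) R) :
    mixedPfaffianSum (Function.update A k (B - C)) =
      mixedPfaffianSum (Function.update A k B) - mixedPfaffianSum (Function.update A k C) := by
  have hprod (X : Matrix (κ ⊕ κ) (κ ⊕ κ) R) (σ : Perm (κ ⊕ κ)) :
      ∏ l, Function.update A k X l (σ (.inl l)) (σ (.inr l)) =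
        X (σ (.inl k)) (σ (.inr k)) *
          ∏ l ∈ Finset.univ.erase k, A l (σ (.inl l)) (σ (.inr l)) := by
    rw [← Finset.mul_prod_erase _ _ (Finset.mem_univ k), Function.update_self]
    congr 1
    refine Finset.prod_congr rfl fun l hl => ?_
    rw [Function.update_of_ne (Finset.ne_of_mem_erase hl)]
  simp only [mixedPfaffianSum, hprod, Matrix.sub_apply, sub_mul, mul_sub, Finset.sum_sub_distrib]

theorem mixedPfaffianSum_update_transpose (A : κ → Matrix (κ ⊕ κ) (κ ⊕ κ) R) (k : κ) :
    mixedPfaffianSum (Function.update A k (A k)ᵀ) = -mixedPfaffianSum A := by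
  rw [mixedPfaffianSum, mixedPfaffianSum, ← Finset.sum_neg_distrib]
  let swapPair : Perm (κ ⊕ κ) := Equiv.swap (.inl k) (.inr k)
  refine Fintype.sum_equiv (Equiv.mulRight swapPair) _ _ fun σ => ?_
  have hprod : ∏ l, Function.update A k (A k)ᵀ l (σ (.inl l)) (σ (.inr l)) =
      ∏ l, A l ((σ * swapPair) (.inl l)) ((σ * swapPair) (.inr l)) := by
    refine Finset.prod_congr rfl fun l _ => ?_
    obtain rfl | hl := eq_or_ne l k
    · simp [swapPair]
    · rw [Function.update_of_ne hl, Perm.mul_apply, Perm.mul_apply,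
        swap_apply_of_ne_of_ne (by simpa) (by simp), swap_apply_of_ne_of_ne (by simp) (by simpa)]
  rw [hprod, coe_mulRight, Perm.sign_mul, Perm.sign_swap Sum.inl_ne_inr]
  simp

theorem pfaffianSum_sub_transpose (A : Matrix (κ ⊕ κ) (κ ⊕ κ) R) :
    pfaffianSum (A - Aᵀ) = 2 ^ Fintype.card κ * pfaffianSum A := by
  suffices ∀ s : Finset κ, mixedPfaffianSum (s.piecewise (fun _ => A - Aᵀ) fun _ => A) =
      2 ^ s.card * pfaffianSum A by
    simpa only [Finset.piecewise_univ, Finset.card_univ, pfaffianSum] using this Finset.univ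
  intro s
  induction s using Finset.induction_on with
  | empty => simp [pfaffianSum]
  | insert k s hk ih =>
    set B := s.piecewise (fun _ => A - Aᵀ) fun _ => A
    have hBk : B k = A := s.piecewise_eq_of_notMem _ _ hk
    have hself : Function.update B k A = B := by
      conv_lhs => rw [← hBk, Function.update_eq_self]
    have htranspose := mixedPfaffianSum_update_transpose B k
    rw [hBk] at htranspose
    rw [Finset.piecewise_insert, mixedPfaffianSum_update_sub, hself, htranspose, ih,
      Finset.card_insert_of_notMem hk]
    ring

theorem sum_mul_det_submatrix [Fintype ι] [DecidableEq ι] (B : Matrix ι ι R)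
    (c : (ι → ι) → R) :
    ∑ q : ι → ι, c q * (B.submatrix id q).det =
      B.det * ∑ σ : Perm ι, ((Perm.sign σ : ℤ) : R) * c σ := by
  rw [Finset.mul_sum]
  refine (Finset.sum_of_injOn (fun σ : Perm ι => (σ : ι → ι)) DFunLike.coe_injective.injOn
    (fun _ _ => Finset.mem_coe.2 (Finset.mem_univ _)) (fun q _ hq => ?_) fun σ _ => ?_).symm
  · obtain ⟨i, j, hij, hne⟩ : ∃ i j, q i = q j ∧ i ≠ j := by
      simpa [Function.Injective] using show ¬ q.Injective from fun h =>
        hq ⟨Equiv.ofBijective q (Finite.injective_iff_bijective.1 h), by simp⟩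
    rw [det_zero_of_column_eq hne (by simp [hij]), mul_zero]
  · rw [det_permute']
    ring

theorem pfaffianSum_mul_mul_transpose (A B : Matrix (κ ⊕ κ) (κ ⊕ κ) R) :
    pfaffianSum (B * A * Bᵀ) = B.det * pfaffianSum A := by
  have hentry : ∀ r s, (B * A * Bᵀ) r s =
      ∑ c : (κ ⊕ κ) × (κ ⊕ κ), A c.1 c.2 * (B r c.1 * B s c.2) := by
    intro r s
    simp only [Fintype.sum_prod_type_right, mul_apply, transpose_apply, Finset.sum_mul]
    exact Finset.sum_congr rfl fun _ _ => Finset.sum_congr rfl fun _ _ => by ring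
  let e : (κ → (κ ⊕ κ) × (κ ⊕ κ)) ≃ (κ ⊕ κ → κ ⊕ κ) :=
    (arrowProdEquivProdArrow κ (fun _ => κ ⊕ κ) fun _ => κ ⊕ κ).trans
      (sumArrowEquivProdArrow κ κ (κ ⊕ κ)).symm
  calc pfaffianSum (B * A * Bᵀ)
      = ∑ q : κ → (κ ⊕ κ) × (κ ⊕ κ), ∑ σ : Perm (κ ⊕ κ), ((Perm.sign σ : ℤ) : R) *
          ∏ k, A (q k).1 (q k).2 * (B (σ (.inl k)) (q k).1 * B (σ (.inr k)) (q k).2) := by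
        simp only [pfaffianSum, mixedPfaffianSum, hentry, Finset.prod_univ_sum, Finset.mul_sum,
          Fintype.piFinset_univ]
        rw [Finset.sum_comm]
    _ = ∑ q : κ ⊕ κ → κ ⊕ κ, (∏ k, A (q (.inl k)) (q (.inr k))) * (B.submatrix id q).det := by
        refine Fintype.sum_equiv e _ _ fun q => ?_
        rw [det_apply', Finset.mul_sum]
        refine Finset.sum_congr rfl fun σ _ => ?_
        simp only [e, arrowProdEquivProdArrow, sumArrowEquivProdArrow, trans_apply, coe_fn_mk,
          coe_fn_symm_mk, Fintype.prod_sum_type, Sum.elim_inl, Sum.elim_inr, submatrix_apply, id_eq,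
          Finset.prod_mul_distrib]
        ring
    _ = B.det * pfaffianSum A := sum_mul_det_submatrix B _

theorem pfaffianSum_fromBlocks_zero_one :
    pfaffianSum (fromBlocks 0 1 0 0 : Matrix (κ ⊕ κ) (κ ⊕ κ) R) = (Fintype.card κ).factorial := by
  rw [← Fintype.card_perm, ← nsmul_one, ← Finset.card_univ, ← Finset.sum_const]
  refine (Finset.sum_of_injOn (fun τ : Perm κ => Perm.sumCongr τ τ) (fun τ _ τ' _ h => ?_)
    (fun _ _ => Finset.mem_coe.2 (Finset.mem_univ _)) (fun σ _ hσ => ?_) fun τ _ => ?_).symm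
  · ext k
    simpa using congrArg (· (Sum.inl k)) h
  · by_contra hne
    have hpair (k : κ) : ∃ i, σ (.inl k) = .inl i ∧ σ (.inr k) = .inr i := by
      have hk : (fromBlocks 0 1 0 0 : Matrix (κ ⊕ κ) (κ ⊕ κ) R) (σ (.inl k)) (σ (.inr k)) ≠ 0 :=
        fun h => hne (by rw [Finset.prod_eq_zero (Finset.mem_univ k) h, mul_zero])
      rcases hl : σ (.inl k) with i | i <;> rcases hr : σ (.inr k) with j | j <;>
        simp_all [one_apply]
    choose τ hl hr using hpair
    have hτ : Function.Injective τ := fun k l h =>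
      Sum.inl_injective (σ.injective (by rw [hl, hl, h]))
    refine hσ ⟨Equiv.ofBijective τ (Finite.injective_iff_bijective.1 hτ), by simp, ?_⟩
    ext (k | k) <;> simp [hl, hr]
  · simp [Perm.sign_sumCongr]

theorem pfaffianSum_neg_J : pfaffianSum (-J κ R) =
    2 ^ Fintype.card κ * (Fintype.card κ).factorial := by
  rw [← pfaffianSum_fromBlocks_zero_one, ← pfaffianSum_sub_transpose, fromBlocks_transpose]
  congr 1
  simp [J, fromBlocks_neg, sub_eq_add_neg, fromBlocks_add]

/-- Skew-symmetric matrices with zero diagonal; the second condition is not implied by the first in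
characteristic two. -/
structure IsAlternating (A : Matrix ι ι R) : Prop where
  diag : ∀ i, A i i = 0
  skew : ∀ i j, A i j = -A j i

theorem isAlternating_sub_transpose (A : Matrix ι ι R) : IsAlternating (A - Aᵀ) :=
  ⟨fun i => sub_self (A i i), fun i j => (neg_sub (A j i) (A i j)).symm⟩

/-- The wedge product `u ∧ v` as an alternating matrix. -/
def wedge (u v : ι → R) : Matrix ι ι R := vecMulVec u v - (vecMulVec u v)ᵀ

theorem wedge_apply (u v : ι → R) (i j : ι) : wedge u v i j = u i * v j - u j * v i :=
  rfl

theorem IsAlternating.sub {A B : Matrix ι ι R} (hA : IsAlternating A)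
    (hB : IsAlternating B) : IsAlternating (A - B) where
  diag i := by rw [Matrix.sub_apply, hA.diag, hB.diag, sub_zero]
  skew i j := by rw [Matrix.sub_apply, Matrix.sub_apply, hA.skew i j, hB.skew i j]; ring

section Field

variable {K : Type*} [Field K]

theorem IsAlternating.sub_wedge_apply_eq_zero {A : Matrix ι ι K}
    (hA : IsAlternating A) {p q : ι} (hpq : A p q ≠ 0) {i : ι}
    (hi : i = p ∨ i = q ∨ ∀ j, A i j = 0) (j : ι) :
    (A - wedge (fun l => A l q / A p q) (A p)) i j = 0 := by
  rw [Matrix.sub_apply, wedge_apply]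
  obtain rfl | rfl | hi := hi
  · rw [hA.diag]
    field_simp
    ring
  · rw [hA.diag, hA.skew j i]
    field_simp
    ring
  · rw [hi, hi, hA.skew p i, hi]
    ring

/-- Each wedge product split off kills two of the indices on which the matrix is supported. -/
theorem IsAlternating.exists_eq_sum_wedge {n : ℕ} {A : Matrix ι ι K}
    (hA : IsAlternating A) (s : Finset ι) (hs : s.card ≤ 2 * n) (hAs : ∀ i ∉ s, ∀ j, A i j = 0) :
    ∃ u v : Fin n → ι → K, A = ∑ k, wedge (u k) (v k) := by
  classical
  induction n generalizing s A with
  | zero =>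
    obtain rfl : s = ∅ := by simpa using hs
    exact ⟨0, 0, by ext i j; simpa using hAs i (by simp) j⟩
  | succ n ih =>
    by_cases hzero : A = 0
    · exact ⟨0, 0, by ext i j; simp [hzero, Matrix.sum_apply, wedge_apply]⟩
    obtain ⟨p, q, hpq⟩ : ∃ p q, A p q ≠ 0 := by
      by_contra! h
      exact hzero (Matrix.ext h)
    have hp : p ∈ s := by_contra fun h => hpq (hAs p h q)
    have hq : q ∈ s := by_contra fun h => hpq (by rw [hA.skew, hAs q h, neg_zero])
    have hqp : q ≠ p := fun h => hpq (by rw [h, hA.diag])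
    obtain ⟨u, v, huv⟩ := ih (hA.sub (isAlternating_sub_transpose _)) ((s.erase p).erase q)
      (by
        rw [Finset.card_erase_of_mem (Finset.mem_erase.2 ⟨hqp, hq⟩), Finset.card_erase_of_mem hp]
        omega)
      fun i hi => hA.sub_wedge_apply_eq_zero hpq <| by
        by_contra! h
        exact hi (Finset.mem_erase.2 ⟨h.2.1, Finset.mem_erase.2 ⟨h.1, by_contra fun hi => by
          obtain ⟨j, hj⟩ := h.2.2
          exact hj (hAs i hi j)⟩⟩)
    refine ⟨Fin.cons (fun l => A l q / A p q) u, Fin.cons (A p) v, ?_⟩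
    rw [Fin.sum_univ_succ]
    simp only [Fin.cons_zero, Fin.cons_succ, ← huv]
    exact (add_sub_cancel _ _).symm

theorem IsAlternating.exists_eq_mul_J_mul_transpose {A : Matrix (κ ⊕ κ) (κ ⊕ κ) K}
    (hA : IsAlternating A) : ∃ B, A = B * -J κ K * Bᵀ := by
  obtain ⟨u, v, rfl⟩ := hA.exists_eq_sum_wedge (n := Fintype.card κ) Finset.univ
    (by simp [two_mul]) (by simp)
  let e := Fintype.equivFin κ
  refine ⟨of fun i => Sum.elim (fun k => u (e k) i) fun k => v (e k) i, ?_⟩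
  ext i j
  rw [Matrix.sum_apply, ← e.sum_comp]
  simp [J, wedge_apply, mul_apply, Fintype.sum_sum_type, one_apply, Finset.sum_sub_distrib,
    mul_comm, neg_add_eq_sub]

theorem IsAlternating.pfaffianSum_sq {A : Matrix (κ ⊕ κ) (κ ⊕ κ) K} (hA : IsAlternating A) :
    pfaffianSum A ^ 2 = (2 ^ Fintype.card κ * (Fintype.card κ).factorial) ^ 2 * A.det := by
  obtain ⟨B, rfl⟩ := hA.exists_eq_mul_J_mul_transpose
  have hJ : (-J κ K).det = 1 :=
    SymplecticGroup.det_eq_one (SymplecticGroup.neg_mem (SymplecticGroup.J_mem κ K))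
  rw [pfaffianSum_mul_mul_transpose, pfaffianSum_neg_J, det_mul, det_mul, det_transpose, hJ]
  ring

theorem pfaffianSum_sq [CharZero K] (A : Matrix (κ ⊕ κ) (κ ⊕ κ) K) :
    pfaffianSum A ^ 2 = (Fintype.card κ).factorial ^ 2 * (A - Aᵀ).det := by
  have h := (isAlternating_sub_transpose A).pfaffianSum_sq
  rw [pfaffianSum_sub_transpose, mul_pow, mul_pow, mul_assoc] at h
  exact mul_left_cancel₀ (pow_ne_zero _ (pow_ne_zero _ two_ne_zero)) h

end Field

end Pfaffian

section Fredholm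

open Equiv Matrix

variable {ι : Type*} {R : Type*} [CommRing R] {𝕜 : Type*} [RCLike 𝕜]

theorem det_submatrix_self_eq_zero {n : ℕ} (G : Matrix ι ι R) {φ : Fin n → ι}
    (hφ : ¬ φ.Injective) : (G.submatrix φ φ).det = 0 := by
  obtain ⟨i, j, hij, hne⟩ : ∃ i j, φ i = φ j ∧ i ≠ j := by
    simpa [Function.Injective] using hφ
  exact det_zero_of_row_eq hne (by ext; simp [hij])

variable [Fintype ι]

section Minors

variable [DecidableEq ι]

theorem det_one_add_eq_sum_minors (G : Matrix ι ι R) :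
    (1 + G).det = ∑ s : Finset ι, (G.submatrix (Subtype.val : s → ι) Subtype.val).det := by
  rw [add_comm]
  simp only [← det_piecewise_one_eq_submatrix_det]
  exact (detRowAlternating : (ι → R) [⋀^ι]→ₗ[R] R).map_add_univ G.row (1 : Matrix ι ι R).row

theorem sum_det_submatrix_image_eq (G : Matrix ι ι R) (s : Finset ι) :
    ∑ φ : Fin s.card → ι with Finset.univ.image φ = s, (G.submatrix φ φ).det =
      s.card.factorial * (G.submatrix (Subtype.val : s → ι) Subtype.val).det := by
  have hcard : Fintype.card (Fin s.card ≃ s) = s.card.factorial := by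
    rw [Fintype.card_equiv s.equivFin.symm, Fintype.card_fin]
  rw [← hcard, ← nsmul_eq_mul, ← Finset.card_univ, ← Finset.sum_const]
  refine (Finset.sum_nbij (fun e : Fin s.card ≃ s => Subtype.val ∘ e) (fun e _ => ?_)
    (fun e _ e' _ h => ?_) (fun φ hφ => ?_) fun e _ => ?_).symm
  · simp [← Finset.image_image, Finset.image_univ_equiv]
  · ext i
    exact congrFun h i
  · have hφ : Finset.univ.image φ = s := by simpa using hφ
    have hmem (i) : φ i ∈ s := hφ ▸ Finset.mem_image_of_mem φ (Finset.mem_univ i)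
    have hinj : φ.Injective := by
      rw [← Set.injOn_univ, ← Finset.coe_univ, ← Finset.card_image_iff, hφ, Finset.card_fin]
    exact ⟨Equiv.ofBijective (fun i => ⟨φ i, hmem i⟩)
      ((Fintype.bijective_iff_injective_and_card _).2 ⟨fun i j h => hinj (congrArg Subtype.val h),
        by simp⟩), by simp, rfl⟩
  · rw [← det_submatrix_equiv_self e]
    rfl

theorem sum_det_submatrix (G : Matrix ι ι R) (n : ℕ) :
    ∑ φ : Fin n → ι, (G.submatrix φ φ).det = n.factorial *
      ∑ s ∈ Finset.univ.powersetCard n, (G.submatrix (Subtype.val : s → ι) Subtype.val).det := by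
  rw [← Finset.sum_fiberwise Finset.univ fun φ : Fin n → ι => Finset.univ.image φ,
    Finset.mul_sum, Finset.powersetCard_eq_filter, Finset.powerset_univ, Finset.sum_filter]
  refine Finset.sum_congr rfl fun s _ => ?_
  split_ifs with hs
  · subst hs
    exact sum_det_submatrix_image_eq G s
  · refine Finset.sum_eq_zero fun φ hφ => det_submatrix_self_eq_zero G fun hinj => hs ?_
    rw [← (Finset.mem_filter.1 hφ).2, Finset.card_image_of_injective _ hinj, Finset.card_fin]

theorem hasSum_det_one_add (G : Matrix ι ι 𝕜) :
    HasSum (fun n : ℕ => (n.factorial : 𝕜)⁻¹ * ∑ φ : Fin n → ι, (G.submatrix φ φ).det)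
      (1 + G).det := by
  have hcancel (n : ℕ) (z : 𝕜) : (n.factorial : 𝕜)⁻¹ * (n.factorial * z) = z :=
    inv_mul_cancel_left₀ (Nat.cast_ne_zero.2 n.factorial_ne_zero) z
  simp only [sum_det_submatrix, hcancel]
  rw [det_one_add_eq_sum_minors, ← Finset.powerset_univ, Finset.sum_powerset]
  refine hasSum_sum_of_ne_finset_zero fun n hn => ?_
  rw [Finset.powersetCard_eq_empty.2 (by simpa [Nat.lt_succ_iff] using hn), Finset.sum_empty]

end Minors

theorem det_sum_mul {α : Type*} (u v : ι → α → R) {n : ℕ} (x : Fin n → α) :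
    (of fun i j => ∑ l, u l (x i) * v l (x j)).det =
      ∑ φ : Fin n → ι, ∑ σ : Perm (Fin n), ((Perm.sign σ : ℤ) : R) *
        ∏ i, (v (φ (σ i)) (x i) * u (φ i) (x i)) := by
  classical
  rw [det_apply', Finset.sum_comm]
  refine Finset.sum_congr rfl fun σ _ => ?_
  simp only [of_apply, Finset.prod_univ_sum, Fintype.piFinset_univ]
  rw [← Finset.mul_sum]
  congr 1
  refine (Fintype.sum_equiv (Equiv.arrowCongr σ.symm (Equiv.refl ι)) _ _ fun φ => ?_).symm
  rw [Finset.prod_mul_distrib, Finset.prod_mul_distrib, mul_comm, ← Equiv.prod_comp σ]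
  simp [Equiv.arrowCongr]

section FiniteRank

variable {α : Type*} [MeasurableSpace α] {μ : Measure α} [SigmaFinite μ] {u v : ι → α → 𝕜}

theorem integrable_sign_mul_prod {ι : Type*} {u v : ι → α → 𝕜}
    (hint : ∀ j l, Integrable (fun x => v j x * u l x) μ) {n : ℕ} (φ : Fin n → ι)
    (σ : Perm (Fin n)) :
    Integrable (fun x : Fin n → α => ((Perm.sign σ : ℤ) : 𝕜) *
      ∏ i, (v (φ (σ i)) (x i) * u (φ i) (x i))) (Measure.pi fun _ => μ) :=
  (Integrable.fintype_prod (f := fun i x => v (φ (σ i)) x * u (φ i) x)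
    fun i => hint (φ (σ i)) (φ i)).const_mul _

theorem integrable_det_sum_mul (hint : ∀ j l, Integrable (fun x => v j x * u l x) μ) (n : ℕ) :
    Integrable (fun x : Fin n → α => (of fun i j => ∑ l, u l (x i) * v l (x j)).det)
      (Measure.pi fun _ => μ) := by
  simp only [det_sum_mul]
  exact integrable_finsetSum _ fun φ _ => integrable_finsetSum _ fun σ _ =>
    integrable_sign_mul_prod hint φ σ

theorem integral_det_sum_mul (hint : ∀ j l, Integrable (fun x => v j x * u l x) μ) (n : ℕ) :
    ∫ x : Fin n → α, (of fun i j => ∑ l, u l (x i) * v l (x j)).det ∂(Measure.pi fun _ => μ) =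
      ∑ φ : Fin n → ι, ((of fun j l => ∫ x, v j x * u l x ∂μ).submatrix φ φ).det := by
  simp only [det_sum_mul]
  rw [integral_finsetSum _ fun φ _ => integrable_finsetSum _ fun σ _ =>
    integrable_sign_mul_prod hint φ σ]
  refine Finset.sum_congr rfl fun φ _ => ?_
  rw [integral_finsetSum _ fun σ _ => integrable_sign_mul_prod hint φ σ, det_apply']
  refine Finset.sum_congr rfl fun σ _ => ?_
  rw [integral_const_mul, integral_fintype_prod_eq_prod fun i x => v (φ (σ i)) x * u (φ i) x]
  rfl

theorem hasSum_fredholm_sum_mul [DecidableEq ι]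
    (hint : ∀ j l, Integrable (fun x => v j x * u l x) μ) :
    HasSum (fun n : ℕ => (n.factorial : 𝕜)⁻¹ * ∫ x : Fin n → α,
      (of fun i j => ∑ l, u l (x i) * v l (x j)).det ∂(Measure.pi fun _ => μ))
      (1 + of fun j l => ∫ x, v j x * u l x ∂μ).det := by
  simp only [integral_det_sum_mul hint]
  exact hasSum_det_one_add _

end FiniteRank

end Fredholm

section Confluent

open Matrix

variable {R : Type*} [CommRing R]

theorem det_vandermonde_append {m n : ℕ} (x : Fin m → R) (y : Fin n → R) :
    (vandermonde (Fin.append x y)).det =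
      (∏ i, ∏ j ∈ Finset.Ioi i, (x j - x i)) * (∏ i, ∏ j ∈ Finset.Ioi i, (y j - y i)) *
        ∏ i, ∏ j, (y j - x i) := by
  have hIoi {l : ℕ} (i : Fin l) (g : Fin l → R) :
      ∏ j ∈ Finset.Ioi i, g j = ∏ j, if i < j then g j else 1 := by
    rw [← Finset.prod_filter, Finset.filter_lt_eq_Ioi]
  have hlt (i : Fin m) (j : Fin n) : Fin.castAdd n i < Fin.natAdd m j := by
    simp only [Fin.lt_def, Fin.val_castAdd, Fin.val_natAdd]
    omega
  simp only [det_vandermonde, hIoi, Fin.prod_univ_add, Fin.append_left, Fin.append_right, hlt,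
    (hlt _ _).asymm, (Fin.strictMono_castAdd n).lt_iff_lt, (Fin.strictMono_natAdd m).lt_iff_lt,
    if_true, if_false, Finset.prod_const_one, Finset.prod_mul_distrib]
  ring

theorem det_eval_of_natDegree_le {n : ℕ} {p : Fin n → R[X]} (hp : ∀ j, (p j).natDegree ≤ j)
    (x : Fin n → R) :
    (of fun j k => (p j).eval (x k)).det = (∏ j, (p j).coeff j) * (vandermonde x).det := by
  have hcoeff : (of fun i j : Fin n => (p j).coeff i).det = ∏ j, (p j).coeff j :=
    det_of_isUpperTriangular fun i j hij => coeff_eq_zero_of_natDegree_lt ((hp j).trans_lt hij)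
  rw [← hcoeff, mul_comm, ← det_mul,
    ← eval_matrixOfPolynomials_eq_vandermonde_mul_matrixOfPolynomials x p hp, ← det_transpose]
  rfl

theorem det_eval_sumElim {m n : ℕ} {p : Fin m ⊕ Fin n → R[X]}
    (hp : ∀ r, (p r).natDegree ≤ finSumFinEquiv r) (x : Fin m → R) (y : Fin n → R) :
    (of fun r c => (p r).eval (Sum.elim x y c)).det =
      (∏ r, (p r).coeff (finSumFinEquiv r)) *
        ((∏ i, ∏ j ∈ Finset.Ioi i, (x j - x i)) * (∏ i, ∏ j ∈ Finset.Ioi i, (y j - y i)) *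
          ∏ i, ∏ j, (y j - x i)) := by
  have hq (j : Fin (m + n)) : (p (finSumFinEquiv.symm j)).natDegree ≤ j := by
    simpa using hp (finSumFinEquiv.symm j)
  rw [← det_vandermonde_append, ← finSumFinEquiv.symm.prod_comp]
  simp only [Equiv.apply_symm_apply]
  rw [← det_eval_of_natDegree_le hq, ← det_submatrix_equiv_self finSumFinEquiv]
  congr 1
  ext r (c | c) <;> simp [-Fin.natAdd_eq_addNat]

theorem det_fromCols_mul_mul_add {m n : Type*} [Fintype m] [Fintype n] [DecidableEq m]
    [DecidableEq n] (A : Matrix (m ⊕ n) m R) (B : Matrix (m ⊕ n) n R) (S : Matrix m m R)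
    (D : Matrix m n R) (T : Matrix n n R) :
    (fromCols (A * S) (A * D + B * T)).det = (fromCols A B).det * (S.det * T.det) := by
  rw [← det_fromBlocks_zero₂₁ S D T, ← det_mul, fromCols_mul_fromBlocks, Matrix.mul_zero, add_zero]

theorem prod_prod_Ioi_const (n : ℕ) (c : R) :
    ∏ i : Fin n, ∏ _j ∈ Finset.Ioi i, c = c ^ n.choose 2 := by
  simp only [Finset.prod_const, Fin.card_Ioi, Finset.prod_pow_eq_pow_sum]
  rw [Fin.sum_univ_eq_sum_range (fun i => n - 1 - i), Finset.sum_range_reflect fun i => i,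
    Nat.choose_two_right]
  exact congrArg _ (Finset.sum_range_id n)

theorem eval_map_C_add_X (p : R[X]) (x : R) :
    (p.map C).eval (C x + X) = C (p.eval x) + divX (taylor x p) * X := by
  rw [eval_map, add_comm (C x), ← taylor_coeff_zero, add_comm (C _), divX_mul_X_add]
  rfl

/-- Over `R[X]`, with nodes `x k` and `x k + X`, the evaluation matrix is
`fromCols A (A + X * B)`; the confluent limit is the substitution `X = 0` once the factor `X ^ n`
has been cancelled. -/
theorem det_eval_divX_taylor {n : ℕ} {p : Fin n ⊕ Fin n → R[X]}
    (hp : ∀ r, (p r).natDegree ≤ finSumFinEquiv r) (x : Fin n → R) :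
    (fromCols (of fun r k => C ((p r).eval (x k)))
      (of fun r k => divX (taylor (x k) (p r)))).det =
      (∏ r, C ((p r).coeff (finSumFinEquiv r))) *
        ((∏ i, ∏ j ∈ Finset.Ioi i, (C (x j) - C (x i))) ^ 2 *
          ∏ i, ∏ j ∈ {i}ᶜ, (C (x j) - C (x i) + X)) := by
  set A : Matrix (Fin n ⊕ Fin n) (Fin n) R[X] := of fun r k => C ((p r).eval (x k))
  set B : Matrix (Fin n ⊕ Fin n) (Fin n) R[X] := of fun r k => divX (taylor (x k) (p r))
  have hdet := det_fromCols_mul_mul_add A B 1 1 ((X : R[X]) • 1)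
  rw [Matrix.mul_one, Matrix.mul_smul, Matrix.mul_one] at hdet
  have hcols : fromCols A (A + (X : R[X]) • B) = of fun r c =>
      ((p r).map C).eval (Sum.elim (fun k => C (x k)) (fun k => C (x k) + X) c) := by
    ext1 r (k | k)
    · simp [A]
    · simp [A, B, eval_map_C_add_X, mul_comm]
  have hfactor (i : Fin n) : ∏ j, (C (x j) + X - C (x i)) =
      X * ∏ j ∈ {i}ᶜ, (C (x j) - C (x i) + X) := by
    simp only [Fintype.prod_eq_mul_prod_compl i, add_sub_right_comm, sub_self, zero_add]
  rw [hcols, det_eval_sumElim fun r => natDegree_map_le.trans (hp r)] at hdet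
  simp only [hfactor, coeff_map, add_sub_add_right_eq_sub, Finset.prod_mul_distrib,
    Finset.prod_const, Finset.card_univ, Fintype.card_fin, det_one, one_mul, mul_one,
    det_smul] at hdet
  refine (monic_X_pow n).isRegular.right ?_
  dsimp only
  rw [← hdet]
  ring

theorem det_eval_eval_derivative {n : ℕ} {p : Fin n ⊕ Fin n → R[X]}
    (hp : ∀ r, (p r).natDegree ≤ finSumFinEquiv r) (x : Fin n → R) :
    (fromCols (of fun r k => (p r).eval (x k))
      (of fun r k => (derivative (p r)).eval (x k))).det =
      (-1) ^ n.choose 2 * (∏ r, (p r).coeff (finSumFinEquiv r)) *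
        ∏ j, ∏ k ∈ Finset.Ioi j, (x j - x k) ^ 4 := by
  have h := congrArg constantCoeff (det_eval_divX_taylor hp x)
  rw [RingHom.map_det] at h
  simp only [map_mul, map_prod, map_pow, map_add, map_sub, constantCoeff_apply, coeff_C_zero,
    coeff_X_zero, add_zero] at h
  rw [← prod_prod_Ioi_const, mul_comm (∏ i : Fin n, _), mul_assoc]
  convert h using 2
  · ext r (k | k) <;> simp [coeff_divX]
  · simp only [← Finset.prod_prod_Ioi_mul_eq_prod_prod_off_diag fun j i => x j - x i,
      ← Finset.prod_pow, ← Finset.prod_mul_distrib]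
    exact Finset.prod_congr rfl fun i _ => Finset.prod_congr rfl fun j _ => by ring

end Confluent

section Interval

variable {a b : EReal}

theorem isOpen_interval (a b : EReal) : IsOpen (interval a b) :=
  isOpen_Ioo.preimage continuous_coe_real_ereal

theorem measurableSet_interval (a b : EReal) : MeasurableSet (interval a b) :=
  (isOpen_interval a b).measurableSet

theorem ordConnected_interval (a b : EReal) : (interval a b).OrdConnected :=
  Set.ordConnected_Ioo.preimage_mono EReal.coe_strictMono.monotone

theorem interval_nonempty (hab : a < b) : (interval a b).Nonempty :=
  EReal.lt_iff_exists_real_btwn.1 hab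

theorem ae_mem_interval (a b : EReal) : ∀ᵐ x ∂(intervalMeasure a b), x ∈ interval a b :=
  ae_restrict_mem (measurableSet_interval a b)

instance (a b : EReal) : SigmaFinite (intervalMeasure a b) :=
  inferInstanceAs (SigmaFinite (volume.restrict _))

theorem intervalMeasure_eq_add {y : ℝ} (hy : y ∈ interval a b) :
    intervalMeasure a b = intervalMeasure a y + intervalMeasure y b := by
  have hdisj : Disjoint (interval a y) (interval y b) :=
    Set.disjoint_left.2 fun x hx hx' => hx.2.asymm hx'.1
  rw [intervalMeasure, intervalMeasure, intervalMeasure,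
    ← Measure.restrict_union hdisj (measurableSet_interval y b)]
  refine Measure.restrict_congr_set ?_
  filter_upwards [Measure.ae_ne volume y] with x hx
  refine propext ⟨fun h => ?_, ?_⟩
  · exact hx.lt_or_gt.imp (fun hxy => ⟨h.1, EReal.coe_lt_coe_iff.2 hxy⟩)
      fun hyx => ⟨EReal.coe_lt_coe_iff.2 hyx, h.2⟩
  · rintro (h | h)
    · exact ⟨h.1, h.2.trans hy.2⟩
    · exact ⟨hy.1.trans h.1, h.2⟩

/-- The filter of real `x` tending to the extended real endpoint `a` from the right. -/
noncomputable def leftEnd (a : EReal) : Filter ℝ := comap (↑) (𝓝[>] a)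

/-- The filter of real `x` tending to the extended real endpoint `b` from the left. -/
noncomputable def rightEnd (b : EReal) : Filter ℝ := comap (↑) (𝓝[<] b)

instance (a : EReal) : (leftEnd a).IsCountablyGenerated :=
  inferInstanceAs (comap _ _).IsCountablyGenerated

instance (b : EReal) : (rightEnd b).IsCountablyGenerated :=
  inferInstanceAs (comap _ _).IsCountablyGenerated

theorem interval_mem_leftEnd (hab : a < b) : interval a b ∈ leftEnd a :=
  preimage_mem_comap (Ioo_mem_nhdsGT hab)

theorem interval_mem_rightEnd (hab : a < b) : interval a b ∈ rightEnd b :=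
  preimage_mem_comap (Ioo_mem_nhdsLT hab)

theorem leftEnd_neBot (hab : a < b) : (leftEnd a).NeBot := by
  refine comap_neBot fun s hs => ?_
  obtain ⟨c, hac, hcs⟩ := (mem_nhdsGT_iff_exists_Ioo_subset' hab).1 hs
  obtain ⟨x, hx⟩ := interval_nonempty hac
  exact ⟨x, hcs hx⟩

theorem rightEnd_neBot (hab : a < b) : (rightEnd b).NeBot := by
  refine comap_neBot fun s hs => ?_
  obtain ⟨c, hcb, hcs⟩ := (mem_nhdsLT_iff_exists_Ioo_subset' hab).1 hs
  obtain ⟨x, hx⟩ := interval_nonempty hcb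
  exact ⟨x, hcs hx⟩

theorem leftEnd_coe (y : ℝ) : leftEnd y = 𝓝[>] y := by
  rw [leftEnd, nhdsWithin, comap_inf, comap_principal, ← EReal.isEmbedding_coe.nhds_eq_comap,
    nhdsWithin]
  congr 2
  ext x
  simp

theorem rightEnd_coe (y : ℝ) : rightEnd y = 𝓝[<] y := by
  rw [rightEnd, nhdsWithin, comap_inf, comap_principal, ← EReal.isEmbedding_coe.nhds_eq_comap,
    nhdsWithin]
  congr 2
  ext x
  simp

theorem leftEnd_bot : leftEnd ⊥ = atBot := by
  rw [leftEnd, Set.Ioi_bot, EReal.nhdsWithin_bot, comap_map EReal.coe_injective]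

theorem rightEnd_top : rightEnd ⊤ = atTop := by
  rw [rightEnd, Set.Iio_top, EReal.nhdsWithin_top, comap_map EReal.coe_injective]

theorem aecover_Ioc_leftEnd_prod_rightEnd (a b : EReal) :
    AECover (intervalMeasure a b) (leftEnd a ×ˢ rightEnd b) fun t => Set.Ioc t.1 t.2 where
  ae_eventually_mem := by
    filter_upwards [ae_mem_interval a b] with x hx
    filter_upwards [prod_mem_prod (interval_mem_leftEnd hx.1) (interval_mem_rightEnd hx.2)]
      with t ht
    exact ⟨EReal.coe_lt_coe_iff.1 ht.1.2, (EReal.coe_lt_coe_iff.1 ht.2.1).le⟩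
  measurableSet _ := measurableSet_Ioc

variable {E : Type*} [NormedAddCommGroup E] [NormedSpace ℝ E]

/-- Differentiable functions on the interval with integrable derivative. They are bounded, and
closed under multiplication. -/
structure HasIntegrableDeriv (a b : EReal) (g : ℝ → E) : Prop where
  differentiableOn : DifferentiableOn ℝ g (interval a b)
  integrable_deriv : Integrable (deriv g) (intervalMeasure a b)

/-- Differentiable functions on the interval with integrable derivative and limit zero at both
ends, so that no boundary terms appear in an integration by parts. -/
structure VanishesAtEnds (a b : EReal) (g : ℝ → E) : Prop extends HasIntegrableDeriv a b g where
  left : Tendsto g (leftEnd a) (𝓝 0)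
  right : Tendsto g (rightEnd b) (𝓝 0)

namespace HasIntegrableDeriv

variable {g : ℝ → E}

theorem hasDerivAt (hg : HasIntegrableDeriv a b g) {x : ℝ} (hx : x ∈ interval a b) :
    HasDerivAt g (deriv g x) x :=
  (hg.differentiableOn.differentiableAt ((isOpen_interval a b).mem_nhds hx)).hasDerivAt

theorem mono (hg : HasIntegrableDeriv a b g) {a' b' : EReal} (ha : a ≤ a') (hb : b' ≤ b) :
    HasIntegrableDeriv a' b' g :=
  have hsub : interval a' b' ⊆ interval a b := fun _ hx => ⟨ha.trans_lt hx.1, hx.2.trans_le hb⟩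
  ⟨hg.differentiableOn.mono hsub, IntegrableOn.mono_set hg.integrable_deriv hsub⟩

theorem const_add (hg : HasIntegrableDeriv a b g) (c : E) :
    HasIntegrableDeriv a b fun x => c + g x where
  differentiableOn := hg.differentiableOn.const_add c
  integrable_deriv := by simpa only [deriv_const_add'] using hg.integrable_deriv

theorem aestronglyMeasurable (hg : HasIntegrableDeriv a b g) :
    AEStronglyMeasurable g (intervalMeasure a b) :=
  hg.differentiableOn.continuousOn.aestronglyMeasurable (measurableSet_interval a b)

theorem deriv_mul {A : Type*} [NormedRing A] [NormedAlgebra ℝ A] {g h : ℝ → A}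
    (hg : HasIntegrableDeriv a b g) (hh : HasIntegrableDeriv a b h) {x : ℝ}
    (hx : x ∈ interval a b) :
    deriv (fun x => g x * h x) x = deriv g x * h x + g x * deriv h x :=
  ((hg.hasDerivAt hx).mul (hh.hasDerivAt hx)).deriv

variable [CompleteSpace E]

theorem intervalIntegral_deriv_eq_sub (hg : HasIntegrableDeriv a b g) {x y : ℝ}
    (hx : x ∈ interval a b) (hy : y ∈ interval a b) : ∫ t in x..y, deriv g t = g y - g x :=
  have hsub := (ordConnected_interval a b).uIcc_subset hx hy
  intervalIntegral.integral_eq_sub_of_hasDerivAt (fun _ ht => hg.hasDerivAt (hsub ht))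
    (IntegrableOn.intervalIntegrable (IntegrableOn.mono_set hg.integrable_deriv hsub))

theorem integral_deriv_eq_sub (hg : HasIntegrableDeriv a b g) (hab : a < b) {A B : E}
    (hA : Tendsto g (leftEnd a) (𝓝 A)) (hB : Tendsto g (rightEnd b) (𝓝 B)) :
    ∫ x, deriv g x ∂(intervalMeasure a b) = B - A := by
  have := leftEnd_neBot hab
  have := rightEnd_neBot hab
  refine (aecover_Ioc_leftEnd_prod_rightEnd a b).integral_eq_of_tendsto _ hg.integrable_deriv ?_
  refine ((hB.comp tendsto_snd).sub (hA.comp tendsto_fst)).congr' ?_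
  obtain ⟨y, hy⟩ := interval_nonempty hab
  filter_upwards [prod_mem_prod (interval_mem_leftEnd hy.1) (interval_mem_rightEnd hy.2)]
    with t ht
  have h1 : t.1 ∈ interval a b := ⟨ht.1.1, ht.1.2.trans hy.2⟩
  have h2 : t.2 ∈ interval a b := ⟨hy.1.trans ht.2.1, ht.2.2⟩
  have hle : t.1 ≤ t.2 := (EReal.coe_lt_coe_iff.1 (ht.1.2.trans ht.2.1)).le
  have hsub : Set.Ioc t.1 t.2 ⊆ interval a b :=
    Set.Ioc_subset_Icc_self.trans ((ordConnected_interval a b).out h1 h2)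
  rw [intervalMeasure, Measure.restrict_restrict_of_subset hsub,
    ← intervalIntegral.integral_of_le hle, hg.intervalIntegral_deriv_eq_sub h1 h2]
  rfl

theorem exists_norm_le (hg : HasIntegrableDeriv a b g) : ∃ C, ∀ x ∈ interval a b, ‖g x‖ ≤ C := by
  obtain hempty | ⟨y, hy⟩ := (interval a b).eq_empty_or_nonempty
  · exact ⟨0, by simp [hempty]⟩
  refine ⟨‖g y‖ + ∫ t, ‖deriv g t‖ ∂(intervalMeasure a b), fun x hx => ?_⟩
  have hsub : Set.uIoc y x ⊆ interval a b :=
    Set.uIoc_subset_uIcc.trans ((ordConnected_interval a b).uIcc_subset hy hx)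
  calc ‖g x‖ ≤ ‖g y‖ + ‖g x - g y‖ := norm_le_insert' _ _
    _ ≤ ‖g y‖ + ∫ t in Set.uIoc y x, ‖deriv g t‖ := by
      rw [← hg.intervalIntegral_deriv_eq_sub hy hx]
      gcongr
      exact intervalIntegral.norm_integral_le_integral_norm_uIoc
    _ ≤ ‖g y‖ + ∫ t, ‖deriv g t‖ ∂(intervalMeasure a b) := by
      exact add_le_add le_rfl (setIntegral_mono_set hg.integrable_deriv.norm
        (ae_of_all _ fun _ => norm_nonneg _) hsub.eventuallyLE)

section Mul

variable {A : Type*} [NormedRing A] [NormedAlgebra ℝ A] [CompleteSpace A] {g h φ : ℝ → A}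

theorem integrable_mul (hg : HasIntegrableDeriv a b g) (hφ : Integrable φ (intervalMeasure a b)) :
    Integrable (fun x => g x * φ x) (intervalMeasure a b) := by
  obtain ⟨C, hC⟩ := hg.exists_norm_le
  exact hφ.bdd_mul hg.aestronglyMeasurable ((ae_mem_interval a b).mono hC)

theorem integrable_mul' (hg : HasIntegrableDeriv a b g) (hφ : Integrable φ (intervalMeasure a b)) :
    Integrable (fun x => φ x * g x) (intervalMeasure a b) := by
  obtain ⟨C, hC⟩ := hg.exists_norm_le
  exact hφ.mul_bdd hg.aestronglyMeasurable ((ae_mem_interval a b).mono hC)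

theorem mul (hg : HasIntegrableDeriv a b g) (hh : HasIntegrableDeriv a b h) :
    HasIntegrableDeriv a b fun x => g x * h x where
  differentiableOn := hg.differentiableOn.mul hh.differentiableOn
  integrable_deriv := by
    refine ((hh.integrable_mul' hg.integrable_deriv).add
      (hg.integrable_mul hh.integrable_deriv)).congr ?_
    filter_upwards [ae_mem_interval a b] with x hx using (hg.deriv_mul hh hx).symm

end Mul

theorem tendsto_leftEnd_bot {g : ℝ → ℝ} (hg : HasIntegrableDeriv ⊥ b g) (hb : ⊥ < b)
    (hint : Integrable (fun x => g x * g x) (intervalMeasure ⊥ b)) :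
    Tendsto g (leftEnd ⊥) (𝓝 0) := by
  obtain ⟨y, hy⟩ := interval_nonempty hb
  have hsub : Set.Iic y ⊆ interval ⊥ b := fun x hx =>
    ⟨EReal.bot_lt_coe x, (EReal.coe_le_coe_iff.2 hx).trans_lt hy.2⟩
  have hsq : Tendsto (fun x => g x * g x) atBot (𝓝 0) :=
    tendsto_zero_of_hasDerivAt_of_integrableOn_Iic (fun x hx => (hg.mul hg).hasDerivAt (hsub hx))
      (IntegrableOn.mono_set (hg.mul hg).integrable_deriv hsub) (IntegrableOn.mono_set hint hsub)
  rw [leftEnd_bot, tendsto_zero_iff_abs_tendsto_zero]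
  simp only [Function.comp_def]
  simpa only [Real.sqrt_mul_self_eq_abs, Real.sqrt_zero] using hsq.sqrt

theorem tendsto_rightEnd_top {g : ℝ → ℝ} (hg : HasIntegrableDeriv a ⊤ g) (ha : a < ⊤)
    (hint : Integrable (fun x => g x * g x) (intervalMeasure a ⊤)) :
    Tendsto g (rightEnd ⊤) (𝓝 0) := by
  obtain ⟨y, hy⟩ := interval_nonempty ha
  have hsub : Set.Ioi y ⊆ interval a ⊤ := fun x hx =>
    ⟨hy.1.trans (EReal.coe_lt_coe_iff.2 hx), EReal.coe_lt_top x⟩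
  have hsq : Tendsto (fun x => g x * g x) atTop (𝓝 0) :=
    tendsto_zero_of_hasDerivAt_of_integrableOn_Ioi (fun x hx => (hg.mul hg).hasDerivAt (hsub hx))
      (IntegrableOn.mono_set (hg.mul hg).integrable_deriv hsub) (IntegrableOn.mono_set hint hsub)
  rw [rightEnd_top, tendsto_zero_iff_abs_tendsto_zero]
  simp only [Function.comp_def]
  simpa only [Real.sqrt_mul_self_eq_abs, Real.sqrt_zero] using hsq.sqrt

theorem deriv_ofReal {g : ℝ → ℝ} (hg : HasIntegrableDeriv a b g) {x : ℝ} (hx : x ∈ interval a b) :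
    deriv (fun x => (g x : ℂ)) x = deriv g x :=
  (hg.hasDerivAt hx).ofReal_comp.deriv

theorem ofReal {g : ℝ → ℝ} (hg : HasIntegrableDeriv a b g) :
    HasIntegrableDeriv a b fun x => (g x : ℂ) where
  differentiableOn _ hx := (hg.hasDerivAt hx).ofReal_comp.differentiableAt.differentiableWithinAt
  integrable_deriv := hg.integrable_deriv.ofReal.congr <| by
    filter_upwards [ae_mem_interval a b] with x hx using (hg.deriv_ofReal hx).symm

end HasIntegrableDeriv

theorem hasIntegrableDeriv_zero (a b : EReal) : HasIntegrableDeriv a b (0 : ℝ → E) :=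
  ⟨differentiableOn_const 0, by simpa only [deriv_zero] using integrable_zero _ _ _⟩

theorem hasIntegrableDeriv_schwartzMap (a b : EReal) (f : 𝓢(ℝ, E)) :
    HasIntegrableDeriv a b f :=
  ⟨f.differentiable.differentiableOn, (SchwartzMap.derivCLM ℝ E f).integrable.restrict⟩

namespace VanishesAtEnds

theorem ofReal {g : ℝ → ℝ} (hg : VanishesAtEnds a b g) :
    VanishesAtEnds a b fun x => (g x : ℂ) where
  toHasIntegrableDeriv := hg.toHasIntegrableDeriv.ofReal
  left := by
    simpa [Function.comp_def] using (Complex.continuous_ofReal.tendsto 0).comp hg.left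
  right := by
    simpa [Function.comp_def] using (Complex.continuous_ofReal.tendsto 0).comp hg.right

theorem mul {A : Type*} [NormedRing A] [NormedAlgebra ℝ A] [CompleteSpace A] {g h : ℝ → A}
    (hab : a < b) (hg : VanishesAtEnds a b g) (hh : HasIntegrableDeriv a b h) :
    VanishesAtEnds a b fun x => g x * h x := by
  obtain ⟨C, hC⟩ := hh.exists_norm_le
  exact ⟨hg.toHasIntegrableDeriv.mul hh,
    hg.left.zero_mul_isBoundedUnder_le
      (isBoundedUnder_of_eventually_le (eventually_of_mem (interval_mem_leftEnd hab) hC)),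
    hg.right.zero_mul_isBoundedUnder_le
      (isBoundedUnder_of_eventually_le (eventually_of_mem (interval_mem_rightEnd hab) hC))⟩

theorem integral_deriv_eq_zero [CompleteSpace E] {g : ℝ → E} (hab : a < b)
    (hg : VanishesAtEnds a b g) : ∫ x, deriv g x ∂(intervalMeasure a b) = 0 := by
  rw [hg.integral_deriv_eq_sub hab hg.left hg.right, sub_zero]

theorem integral_deriv_left [CompleteSpace E] {g : ℝ → E} (hg : VanishesAtEnds a b g) {y : ℝ}
    (hy : y ∈ interval a b) : ∫ x, deriv g x ∂(intervalMeasure a y) = g y := by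
  have hlim : Tendsto g (rightEnd y) (𝓝 (g y)) := by
    rw [rightEnd_coe]
    exact (hg.hasDerivAt hy).continuousAt.continuousWithinAt
  rw [(hg.mono le_rfl hy.2.le).integral_deriv_eq_sub hy.1 hg.left hlim, sub_zero]

theorem integral_deriv_right [CompleteSpace E] {g : ℝ → E} (hg : VanishesAtEnds a b g) {y : ℝ}
    (hy : y ∈ interval a b) : ∫ x, deriv g x ∂(intervalMeasure y b) = -g y := by
  have hlim : Tendsto g (leftEnd y) (𝓝 (g y)) := by
    rw [leftEnd_coe]
    exact (hg.hasDerivAt hy).continuousAt.continuousWithinAt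
  rw [(hg.mono hy.1.le le_rfl).integral_deriv_eq_sub hy.2 hlim hg.right, zero_sub]

end VanishesAtEnds

theorem measurable_epsKernel (y : ℝ) : Measurable fun t => epsKernel t y := by
  have hsign : Measurable Real.sign :=
    Measurable.ite measurableSet_Iio measurable_const
      (Measurable.ite measurableSet_Ioi measurable_const measurable_const)
  exact (hsign.comp (measurable_id.sub_const y)).div_const 2

theorem norm_epsKernel_le (x y : ℝ) : ‖epsKernel x y‖ ≤ 1 / 2 := by
  unfold epsKernel
  rcases Real.sign_apply_eq (x - y) with h | h | h <;> rw [h] <;> norm_num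

theorem integrable_mul_epsKernel {μ : Measure ℝ} {φ : ℝ → ℝ} (hφ : Integrable φ μ) (y : ℝ) :
    Integrable (fun t => φ t * epsKernel t y) μ :=
  hφ.mul_bdd (measurable_epsKernel y).aestronglyMeasurable
    (ae_of_all _ fun t => norm_epsKernel_le t y)

theorem VanishesAtEnds.integral_deriv_mul_epsKernel {g : ℝ → ℝ} (hg : VanishesAtEnds a b g) {y : ℝ}
    (hy : y ∈ interval a b) : ∫ t, deriv g t * epsKernel t y ∂(intervalMeasure a b) = -g y := by
  have hint := integrable_mul_epsKernel hg.integrable_deriv y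
  rw [intervalMeasure_eq_add hy] at hint ⊢
  have hleft : ∫ t, deriv g t * epsKernel t y ∂(intervalMeasure a y) = g y * (-1 / 2) := by
    rw [← hg.integral_deriv_left hy, ← integral_mul_const]
    refine integral_congr_ae ?_
    filter_upwards [ae_mem_interval a y] with t ht
    rw [epsKernel, Real.sign_of_neg (sub_neg.2 (EReal.coe_lt_coe_iff.1 ht.2))]
  have hright : ∫ t, deriv g t * epsKernel t y ∂(intervalMeasure y b) = -g y * (1 / 2) := by
    rw [← hg.integral_deriv_right hy, ← integral_mul_const]
    refine integral_congr_ae ?_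
    filter_upwards [ae_mem_interval y b] with t ht
    rw [epsKernel, Real.sign_of_pos (sub_pos.2 (EReal.coe_lt_coe_iff.1 ht.1))]
  rw [integral_add_measure hint.left_of_add_measure hint.right_of_add_measure, hleft, hright]
  ring

end Interval

section Psi

variable {a b : EReal} {w : ℝ → ℝ} {q : ℝ[X]}

theorem hasDerivAt_psi (hw_diff : DifferentiableOn ℝ (fun x => √(w x)) (interval a b)) (q : ℝ[X])
    {x : ℝ} (hx : x ∈ interval a b) :
    HasDerivAt (psi w q)
      (q.eval x * deriv (fun x => √(w x)) x + (derivative q).eval x * √(w x)) x := by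
  rw [add_comm]
  exact (q.hasDerivAt x).mul
    (hw_diff.differentiableAt ((isOpen_interval a b).mem_nhds hx)).hasDerivAt

theorem integrable_psi_mul_self (hw_nonneg : ∀ x ∈ interval a b, 0 ≤ w x)
    (hw_moments : ∀ j : ℕ, Integrable (fun x => x ^ j * w x) (intervalMeasure a b)) (q : ℝ[X]) :
    Integrable (fun x => psi w q x * psi w q x) (intervalMeasure a b) := by
  have hpoly : Integrable (fun x => (q * q).eval x * w x) (intervalMeasure a b) := by
    simp only [eval_eq_sum_range, Finset.sum_mul, mul_assoc]
    exact integrable_finsetSum _ fun j _ => (hw_moments j).const_mul _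
  refine hpoly.congr ?_
  filter_upwards [ae_mem_interval a b] with x hx
  rw [psi, mul_mul_mul_comm, Real.mul_self_sqrt (hw_nonneg x hx), eval_mul]

theorem tendsto_psi_of_tendsto {x : ℝ} {l : Filter ℝ} (hl : l ≤ 𝓝 x) (hw : Tendsto w l (𝓝 0)) :
    Tendsto (psi w q) l (𝓝 0) := by
  have h := ((q.continuous.tendsto x).mono_left hl).mul hw.sqrt
  rwa [Real.sqrt_zero, mul_zero] at h

theorem tendsto_psi_leftEnd (hab : a < b) (hψ : HasIntegrableDeriv a b (psi w q))
    (hint : Integrable (fun x => psi w q x * psi w q x) (intervalMeasure a b))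
    (hw_left : Tendsto w (leftEnd a) (𝓝 0)) : Tendsto (psi w q) (leftEnd a) (𝓝 0) := by
  induction a with
  | bot => exact hψ.tendsto_leftEnd_bot hab hint
  | top => exact absurd hab not_top_lt
  | coe a => exact tendsto_psi_of_tendsto ((leftEnd_coe a).trans_le nhdsWithin_le_nhds) hw_left

theorem tendsto_psi_rightEnd (hab : a < b) (hψ : HasIntegrableDeriv a b (psi w q))
    (hint : Integrable (fun x => psi w q x * psi w q x) (intervalMeasure a b))
    (hw_right : Tendsto w (rightEnd b) (𝓝 0)) : Tendsto (psi w q) (rightEnd b) (𝓝 0) := by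
  induction b with
  | bot => exact absurd hab not_lt_bot
  | top => exact hψ.tendsto_rightEnd_top hab hint
  | coe b => exact tendsto_psi_of_tendsto ((rightEnd_coe b).trans_le nhdsWithin_le_nhds) hw_right

theorem vanishesAtEnds_psi (hab : a < b) (hw_nonneg : ∀ x ∈ interval a b, 0 ≤ w x)
    (hw_moments : ∀ j : ℕ, Integrable (fun x => x ^ j * w x) (intervalMeasure a b))
    (hw_diff : DifferentiableOn ℝ (fun x => √(w x)) (interval a b))
    (hw_left : Tendsto w (leftEnd a) (𝓝 0)) (hw_right : Tendsto w (rightEnd b) (𝓝 0))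
    (hq : Integrable (deriv (psi w q)) (intervalMeasure a b)) :
    VanishesAtEnds a b (psi w q) :=
  have hψ : HasIntegrableDeriv a b (psi w q) :=
    ⟨fun _ hx => (hasDerivAt_psi hw_diff q hx).differentiableAt.differentiableWithinAt, hq⟩
  have hint := integrable_psi_mul_self hw_nonneg hw_moments q
  ⟨hψ, tendsto_psi_leftEnd hab hψ hint hw_left, tendsto_psi_rightEnd hab hψ hint hw_right⟩

theorem integrable_momentIntegrand {n : ℕ} {p : Fin n → ℝ[X]}
    (hψ : ∀ j, HasIntegrableDeriv a b (psi w (p j))) (j k : Fin n) :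
    Integrable (momentIntegrand w p j k) (intervalMeasure a b) :=
  ((hψ j).integrable_mul (hψ k).integrable_deriv).sub
    ((hψ k).integrable_mul' (hψ j).integrable_deriv)

end Psi

section DeBruijn

open Equiv Matrix

section General

variable {κ : Type*} [Fintype κ] [DecidableEq κ] {α : Type*} {R : Type*} [CommRing R]

/-- The square matrix whose columns are the values of the family `g` at the points `x k`, followed
by those of `h`: the matrix under the integral in de Bruijn's formula for `β = 4`. -/
def deBruijnMatrix (g h : κ ⊕ κ → α → R) (x : κ → α) : Matrix (κ ⊕ κ) (κ ⊕ κ) R :=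
  fromCols (of fun r k => g r (x k)) (of fun r k => h r (x k))

theorem det_deBruijnMatrix (g h : κ ⊕ κ → α → R) (x : κ → α) :
    (deBruijnMatrix g h x).det =
      mixedPfaffianSum fun k => of fun r s => g r (x k) * h s (x k) := by
  simp only [det_apply', mixedPfaffianSum, Fintype.prod_sum_type, ← Finset.prod_mul_distrib,
    deBruijnMatrix, fromCols_apply_inl, fromCols_apply_inr, of_apply]

theorem det_deBruijnMatrix_mul (g h : κ ⊕ κ → α → R) (φ : α → R) (x : κ → α) :
    (deBruijnMatrix (fun r t => g r t * φ t) h x).det =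
      (deBruijnMatrix g h x).det * ∏ k, φ (x k) := by
  have := det_fromCols_mul_mul_add (of fun r k => g r (x k)) (of fun r k => h r (x k))
    (diagonal fun k => φ (x k)) 0 1
  simp only [Matrix.mul_zero, Matrix.mul_one, zero_add, det_diagonal, det_one, mul_one] at this
  rw [deBruijnMatrix, deBruijnMatrix, ← this]
  congr 2
  ext r k
  simp

theorem map_det_deBruijnMatrix {S : Type*} [CommRing S] (e : R →+* S) (g h : κ ⊕ κ → α → R)
    (x : κ → α) :
    e (deBruijnMatrix g h x).det =
      (deBruijnMatrix (fun r t => e (g r t)) (fun r t => e (h r t)) x).det := by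
  rw [e.map_det, RingHom.mapMatrix_apply, deBruijnMatrix, fromCols_map]
  rfl

variable [MeasurableSpace α] {μ : Measure α} [SigmaFinite μ] {𝕜 : Type*} [RCLike 𝕜]
  {g h : κ ⊕ κ → α → 𝕜}

theorem integrable_det_deBruijnMatrix (hint : ∀ r s, Integrable (fun t => g r t * h s t) μ) :
    Integrable (fun x => (deBruijnMatrix g h x).det) (Measure.pi fun _ : κ => μ) := by
  simp only [det_deBruijnMatrix, mixedPfaffianSum, of_apply]
  exact integrable_finsetSum _ fun σ _ => (Integrable.fintype_prod
    (f := fun k t => g (σ (.inl k)) t * h (σ (.inr k)) t) fun _ => hint _ _).const_mul _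

theorem integral_det_deBruijnMatrix (hint : ∀ r s, Integrable (fun t => g r t * h s t) μ) :
    ∫ x, (deBruijnMatrix g h x).det ∂(Measure.pi fun _ : κ => μ) =
      pfaffianSum (of fun r s => ∫ t, g r t * h s t ∂μ) := by
  simp only [det_deBruijnMatrix, mixedPfaffianSum, pfaffianSum, of_apply]
  rw [integral_finsetSum _ fun σ _ => (Integrable.fintype_prod
    (f := fun k t => g (σ (.inl k)) t * h (σ (.inr k)) t) fun _ => hint _ _).const_mul _]
  refine Finset.sum_congr rfl fun σ _ => ?_
  rw [integral_const_mul, integral_fintype_prod_eq_prod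
    fun k t => g (σ (.inl k)) t * h (σ (.inr k)) t]

theorem integral_det_deBruijnMatrix_sq (hint : ∀ r s, Integrable (fun t => g r t * h s t) μ) :
    (∫ x, (deBruijnMatrix g h x).det ∂(Measure.pi fun _ : κ => μ)) ^ 2 =
      (Fintype.card κ).factorial ^ 2 *
        (of fun r s => ∫ t, (g r t * h s t - g s t * h r t) ∂μ).det := by
  rw [integral_det_deBruijnMatrix hint, pfaffianSum_sq]
  congr 2
  ext r s
  exact (integral_sub (hint r s) (hint s r)).symm

end General

section Ensemble

variable {a b : EReal} {w : ℝ → ℝ} {N : ℕ} {p : Fin (2 * N) → ℝ[X]} {f : ℝ → ℂ}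

/-- The matrix `∫ (ψ_j ψ_k' - ψ_j' ψ_k) φ`, which is `M^{(4)}` for `φ = 1`. -/
noncomputable def weightedMomentMatrix (a b : EReal) (w : ℝ → ℝ) {n : ℕ} (p : Fin n → ℝ[X])
    (φ : ℝ → ℂ) : Matrix (Fin n) (Fin n) ℂ :=
  of fun j k => ∫ x, (momentIntegrand w p j k x : ℂ) * φ x ∂(intervalMeasure a b)

theorem weightedMomentMatrix_one_add {n : ℕ} {p : Fin n → ℝ[X]}
    (hψ : ∀ j, HasIntegrableDeriv a b (psi w (p j))) (hf : HasIntegrableDeriv a b f) :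
    weightedMomentMatrix a b w p (fun x => 1 + f x) =
      (momentMatrix a b w p).map Complex.ofReal + weightedMomentMatrix a b w p f := by
  ext j k
  have hint := (integrable_momentIntegrand hψ j k).ofReal (𝕜 := ℂ)
  simp only [weightedMomentMatrix, momentMatrix, of_apply, Matrix.add_apply, map_apply, mul_add,
    mul_one]
  rw [← integral_complex_ofReal]
  exact integral_add hint (hf.integrable_mul' hint)

theorem weightedMomentMatrix_zero {n : ℕ} (p : Fin n → ℝ[X]) :
    weightedMomentMatrix a b w p 0 = 0 := by
  ext j k
  simp [weightedMomentMatrix]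

theorem prod_leadingCoeff_ne_zero {n : ℕ} {p : Fin n → ℝ[X]}
    (hp : ∀ j, (p j).degree = ((j : ℕ) : WithBot ℕ)) : ∏ j, (p j).leadingCoeff ≠ 0 :=
  Finset.prod_ne_zero_iff.2 fun j _ => leadingCoeff_ne_zero.2 fun h => by simpa [h] using hp j

theorem ae_pi_mem_interval (a b : EReal) (N : ℕ) :
    ∀ᵐ x ∂(Measure.pi fun _ : Fin N => intervalMeasure a b), ∀ k, x k ∈ interval a b :=
  Measure.ae_pi_le_pi (eventually_pi fun _ => ae_mem_interval a b)

/-- The indices `0, …, 2N - 1` as the first `N` followed by the last `N`. -/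
def splitEquiv (N : ℕ) : Fin N ⊕ Fin N ≃ Fin (2 * N) :=
  finSumFinEquiv.trans (finCongr (two_mul N).symm)

theorem det_deBruijnMatrix_psi (hw_nonneg : ∀ x ∈ interval a b, 0 ≤ w x)
    (hw_diff : DifferentiableOn ℝ (fun x => √(w x)) (interval a b))
    (hp : ∀ j, (p j).natDegree = j) {x : Fin N → ℝ} (hx : ∀ k, x k ∈ interval a b) :
    (deBruijnMatrix (fun r => psi w (p (splitEquiv N r)))
      (fun r => deriv (psi w (p (splitEquiv N r)))) x).det =
      (-1) ^ N.choose 2 * (∏ j, (p j).leadingCoeff) * density w N x := by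
  have hcols : deBruijnMatrix (fun r => psi w (p (splitEquiv N r)))
      (fun r => deriv (psi w (p (splitEquiv N r)))) x =
      fromCols ((of fun r k => (p (splitEquiv N r)).eval (x k)) * diagonal fun k => √(w (x k)))
        ((of fun r k => (p (splitEquiv N r)).eval (x k)) *
            (diagonal fun k => deriv (fun x => √(w x)) (x k)) +
          (of fun r k => (derivative (p (splitEquiv N r))).eval (x k)) *
            diagonal fun k => √(w (x k))) := by
    ext r (k | k)
    · simp [deBruijnMatrix, psi]
    · simp [deBruijnMatrix, (hasDerivAt_psi hw_diff _ (hx k)).deriv]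
  have hcoeff : ∏ r, (p (splitEquiv N r)).coeff (finSumFinEquiv r) =
      ∏ j, (p j).leadingCoeff := by
    rw [← (splitEquiv N).prod_comp]
    exact Finset.prod_congr rfl fun r _ => by rw [leadingCoeff, hp]; rfl
  have hsqrt : ∏ k, √(w (x k)) * √(w (x k)) = ∏ k, w (x k) :=
    Finset.prod_congr rfl fun k _ => Real.mul_self_sqrt (hw_nonneg _ (hx k))
  rw [hcols, det_fromCols_mul_mul_add, det_diagonal, ← Finset.prod_mul_distrib, hsqrt,
    det_eval_eval_derivative (fun r => (hp _).le), hcoeff, density, mul_assoc]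

theorem det_deBruijnMatrix_psi_mul (hw_nonneg : ∀ x ∈ interval a b, 0 ≤ w x)
    (hw_diff : DifferentiableOn ℝ (fun x => √(w x)) (interval a b))
    (hp : ∀ j, (p j).natDegree = j) (f : ℝ → ℂ) {x : Fin N → ℝ} (hx : ∀ k, x k ∈ interval a b) :
    (deBruijnMatrix (fun r t => (psi w (p (splitEquiv N r)) t : ℂ) * (1 + f t))
      (fun r t => ((deriv (psi w (p (splitEquiv N r))) t : ℝ) : ℂ)) x).det =
      (((-1) ^ N.choose 2 * ∏ j, (p j).leadingCoeff : ℝ) : ℂ) * deformedDensity w N f x := by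
  have hreal := map_det_deBruijnMatrix Complex.ofRealHom (fun r => psi w (p (splitEquiv N r)))
    (fun r => deriv (psi w (p (splitEquiv N r)))) x
  rw [det_deBruijnMatrix_psi hw_nonneg hw_diff hp hx, map_mul] at hreal
  rw [det_deBruijnMatrix_mul, deformedDensity, ← mul_assoc]
  exact congrArg (· * _) hreal.symm

theorem integrable_psi_mul_deriv_psi (hψ : ∀ j, HasIntegrableDeriv a b (psi w (p j)))
    (hf : HasIntegrableDeriv a b f) (j k : Fin (2 * N)) :
    Integrable (fun t => (psi w (p j) t : ℂ) * (1 + f t) * ((deriv (psi w (p k)) t : ℝ) : ℂ))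
      (intervalMeasure a b) :=
  ((hψ j).ofReal.mul (hf.const_add 1)).integrable_mul (hψ k).integrable_deriv.ofReal

theorem integrable_deformedDensity (hw_nonneg : ∀ x ∈ interval a b, 0 ≤ w x)
    (hw_diff : DifferentiableOn ℝ (fun x => √(w x)) (interval a b))
    (hp : ∀ j, (p j).degree = ((j : ℕ) : WithBot ℕ))
    (hψ : ∀ j, HasIntegrableDeriv a b (psi w (p j))) (hf : HasIntegrableDeriv a b f) :
    Integrable (deformedDensity w N f) (Measure.pi fun _ => intervalMeasure a b) := by
  have hc : ((-1) ^ N.choose 2 * ∏ j, (p j).leadingCoeff : ℝ) ≠ 0 :=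
    mul_ne_zero (by simp) (prod_leadingCoeff_ne_zero hp)
  refine (integrable_const_mul_iff (Complex.ofReal_ne_zero.2 hc).isUnit _).1 ?_
  refine (integrable_det_deBruijnMatrix fun r s =>
    integrable_psi_mul_deriv_psi hψ hf (splitEquiv N r) (splitEquiv N s)).congr ?_
  filter_upwards [ae_pi_mem_interval a b N] with x hx using
    det_deBruijnMatrix_psi_mul hw_nonneg hw_diff (fun j => natDegree_eq_of_degree_eq_some (hp j))
      f hx

theorem integral_deformedDensity_sq (hw_nonneg : ∀ x ∈ interval a b, 0 ≤ w x)
    (hw_diff : DifferentiableOn ℝ (fun x => √(w x)) (interval a b))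
    (hp : ∀ j, (p j).natDegree = j)
    (hψ : ∀ j, HasIntegrableDeriv a b (psi w (p j))) (hf : HasIntegrableDeriv a b f) :
    ((∏ j, (p j).leadingCoeff : ℝ) : ℂ) ^ 2 *
        (∫ x, deformedDensity w N f x ∂(Measure.pi fun _ => intervalMeasure a b)) ^ 2 =
      N.factorial ^ 2 * (weightedMomentMatrix a b w p fun x => 1 + f x).det := by
  have hsq := integral_det_deBruijnMatrix_sq fun r s =>
    integrable_psi_mul_deriv_psi hψ hf (splitEquiv N r) (splitEquiv N s)
  have hdet : ∫ x, (deBruijnMatrix (fun r t => (psi w (p (splitEquiv N r)) t : ℂ) * (1 + f t))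
      (fun r t => ((deriv (psi w (p (splitEquiv N r))) t : ℝ) : ℂ)) x).det
        ∂(Measure.pi fun _ => intervalMeasure a b) =
      (((-1) ^ N.choose 2 * ∏ j, (p j).leadingCoeff : ℝ) : ℂ) *
        ∫ x, deformedDensity w N f x ∂(Measure.pi fun _ => intervalMeasure a b) := by
    rw [← integral_const_mul]
    refine integral_congr_ae ?_
    filter_upwards [ae_pi_mem_interval a b N] with x hx using
      det_deBruijnMatrix_psi_mul hw_nonneg hw_diff hp f hx
  have hmatrix : (of fun r s => ∫ t, ((psi w (p (splitEquiv N r)) t : ℂ) * (1 + f t) *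
        ((deriv (psi w (p (splitEquiv N s))) t : ℝ) : ℂ) -
      (psi w (p (splitEquiv N s)) t : ℂ) * (1 + f t) *
        ((deriv (psi w (p (splitEquiv N r))) t : ℝ) : ℂ)) ∂(intervalMeasure a b)) =
      (weightedMomentMatrix a b w p fun x => 1 + f x).submatrix (splitEquiv N)
        (splitEquiv N) := by
    ext r s
    simp only [weightedMomentMatrix, submatrix_apply, of_apply, momentIntegrand]
    congr with t
    push_cast
    ring
  have hsign : (((-1) ^ N.choose 2 * ∏ j, (p j).leadingCoeff : ℝ) : ℂ) ^ 2 =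
      ((∏ j, (p j).leadingCoeff : ℝ) : ℂ) ^ 2 := by
    push_cast
    rw [mul_pow, ← pow_mul, mul_comm _ 2, pow_mul, neg_one_sq, one_pow, one_mul]
  rw [hdet, hmatrix, det_submatrix_equiv_self, mul_pow, hsign, Fintype.card_fin] at hsq
  exact hsq

end Ensemble

end DeBruijn

section Positivity

variable {a b : EReal} {w : ℝ → ℝ} {N : ℕ}

theorem density_nonneg {x : Fin N → ℝ} (hw : ∀ k, 0 ≤ w (x k)) : 0 ≤ density w N x :=
  mul_nonneg
    (Finset.prod_nonneg fun _ _ => Finset.prod_nonneg fun _ _ => (even_two_mul 2).pow_nonneg _)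
    (Finset.prod_nonneg fun k _ => hw k)

theorem density_ne_zero {x : Fin N → ℝ} (hw : ∀ k, w (x k) ≠ 0) (hx : x.Injective) :
    density w N x ≠ 0 :=
  mul_ne_zero
    (Finset.prod_ne_zero_iff.2 fun _ _ => Finset.prod_ne_zero_iff.2 fun _ hk =>
      pow_ne_zero _ (sub_ne_zero.2 (hx.ne (Finset.mem_Ioi.1 hk).ne)))
    (Finset.prod_ne_zero_iff.2 fun k _ => hw k)

theorem isOpen_setOf_injective (ι X : Type*) [Finite ι] [TopologicalSpace X] [T2Space X] :
    IsOpen {x : ι → X | x.Injective} := by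
  simp only [Function.injective_iff_pairwise_ne, Pairwise, Set.ofPred_forall]
  exact isOpen_iInter_of_finite fun i => isOpen_iInter_of_finite fun j =>
    isOpen_iInter_of_finite fun _ => isOpen_ne_fun (continuous_apply i) (continuous_apply j)

theorem measure_pi_injective_pos {U : Set ℝ} (hU : IsOpen U) (hne : U.Nonempty)
    (hsub : U ⊆ interval a b) (N : ℕ) :
    0 < (Measure.pi fun _ : Fin N => intervalMeasure a b)
      (Set.univ.pi (fun _ => U) ∩ {x | x.Injective}) := by
  have hopen : IsOpen (Set.univ.pi (fun _ : Fin N => U) ∩ {x | x.Injective}) :=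
    (isOpen_set_pi Set.finite_univ fun _ _ => hU).inter (isOpen_setOf_injective _ _)
  have hnonempty : (Set.univ.pi (fun _ : Fin N => U) ∩ {x | x.Injective}).Nonempty := by
    obtain ⟨y, hy⟩ := hne
    have e := (infinite_of_mem_nhds y (hU.mem_nhds hy)).natEmbedding
    exact ⟨fun k => e k, fun k _ => (e k).2,
      Subtype.val_injective.comp (e.injective.comp Fin.val_injective)⟩
  have hmeasure : (Measure.pi fun _ : Fin N => intervalMeasure a b) =
      volume.restrict (Set.univ.pi fun _ => interval a b) :=
    (Measure.restrict_pi_pi _ _).symm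
  rw [hmeasure, Measure.restrict_apply hopen.measurableSet,
    Set.inter_eq_left.2 (Set.inter_subset_left.trans (Set.pi_mono fun _ _ => hsub))]
  exact hopen.measure_pos _ hnonempty

theorem partitionFunction_pos (hw_nonneg : ∀ x ∈ interval a b, 0 ≤ w x)
    (hw_pos : ∃ x ∈ interval a b, 0 < w x) (hw_cont : ContinuousOn w (interval a b))
    (hint : Integrable (density w N) (Measure.pi fun _ => intervalMeasure a b)) :
    0 < partitionFunction a b w N := by
  have hnonneg : 0 ≤ᵐ[Measure.pi fun _ => intervalMeasure a b] density w N := by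
    filter_upwards [ae_pi_mem_interval a b N] with x hx using
      density_nonneg fun k => hw_nonneg _ (hx k)
  have hopen : IsOpen (interval a b ∩ w ⁻¹' Set.Ioi 0) :=
    hw_cont.isOpen_inter_preimage (isOpen_interval a b) isOpen_Ioi
  rw [partitionFunction, integral_pos_iff_support_of_nonneg_ae hnonneg hint]
  refine (measure_pi_injective_pos hopen hw_pos Set.inter_subset_left N).trans_le
    (measure_mono fun x hx => density_ne_zero (fun k => ?_) hx.2)
  exact (hx.1 k (Set.mem_univ k)).2.ne'

end Positivity

section Kernel

open Matrix

variable {a b : EReal} {w : ℝ → ℝ} {n : ℕ} {p : Fin n → ℝ[X]} {f : ℝ → ℂ}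

theorem integrable_kernel22_mul_epsKernel (hψ : ∀ j, HasIntegrableDeriv a b (psi w (p j)))
    (x y : ℝ) :
    Integrable (fun t => kernel22 a b w p x t * epsKernel t y) (intervalMeasure a b) :=
  integrable_mul_epsKernel (integrable_finsetSum _ fun _ _ => integrable_finsetSum _ fun k _ =>
    (hψ k).integrable_deriv.const_mul _).neg y

theorem compKernel_kernel22_epsKernel (hψ : ∀ j, VanishesAtEnds a b (psi w (p j))) (x : ℝ)
    {y : ℝ} (hy : y ∈ interval a b) :
    compKernel a b (kernel22 a b w p) epsKernel x y =
      ∑ j, ∑ k, psi w (p j) x * (momentMatrix a b w p)⁻¹ j k * psi w (p k) y := by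
  have hint : ∀ j k, Integrable (fun t => psi w (p j) x * ((momentMatrix a b w p)⁻¹ j k *
      (deriv (psi w (p k)) t * epsKernel t y))) (intervalMeasure a b) := fun j k =>
    ((integrable_mul_epsKernel (hψ k).integrable_deriv y).const_mul _).const_mul _
  simp only [compKernel, kernel22, neg_mul, Finset.sum_mul, mul_assoc, integral_neg]
  rw [integral_finsetSum _ fun j _ => integrable_finsetSum _ fun k _ => hint j k,
    ← Finset.sum_neg_distrib]
  refine Finset.sum_congr rfl fun j _ => ?_
  rw [integral_finsetSum _ fun k _ => hint j k, ← Finset.sum_neg_distrib]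
  refine Finset.sum_congr rfl fun k _ => ?_
  rw [integral_const_mul, integral_const_mul, (hψ k).integral_deriv_mul_epsKernel hy, mul_neg,
    mul_neg, neg_neg]

/-- The functions `v_j` in the finite-rank decomposition `∑_j ψ_j(x) v_j(y)` of the kernel of
`2 K f - K ε f'`. -/
noncomputable def rightFactor (a b : EReal) (w : ℝ → ℝ) (p : Fin n → ℝ[X]) (f : ℝ → ℂ)
    (j : Fin n) (y : ℝ) : ℂ :=
  -∑ k, (((momentMatrix a b w p)⁻¹ j k : ℝ) : ℂ) *
    (2 * ((deriv (psi w (p k)) y : ℝ) : ℂ) * f y + (psi w (p k) y : ℂ) * deriv f y)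

theorem scalarKernel_eq_sum (hψ : ∀ j, VanishesAtEnds a b (psi w (p j))) (f : ℝ → ℂ) (x : ℝ)
    {y : ℝ} (hy : y ∈ interval a b) :
    scalarKernel a b w p f x y = ∑ j, (psi w (p j) x : ℂ) * rightFactor a b w p f j y := by
  rw [scalarKernel, mulKernel, mulKernel, compKernel_kernel22_epsKernel hψ x hy, kernel22]
  push_cast
  simp only [rightFactor, neg_mul, mul_neg, Finset.mul_sum, Finset.sum_mul,
    Finset.sum_neg_distrib]
  rw [← neg_add', ← Finset.sum_add_distrib]
  refine congrArg _ (Finset.sum_congr rfl fun j _ => ?_)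
  rw [← Finset.sum_add_distrib]
  exact Finset.sum_congr rfl fun k _ => by ring

section Pairing

variable {A : Type*} [NormedCommRing A] [NormedAlgebra ℝ A] [CompleteSpace A] {g h φ : ℝ → A}

theorem HasIntegrableDeriv.integrable_pairing (hg : HasIntegrableDeriv a b g)
    (hh : HasIntegrableDeriv a b h) (hφ : HasIntegrableDeriv a b φ) :
    Integrable (fun x => (2 * deriv h x * φ x + h x * deriv φ x) * g x) (intervalMeasure a b) :=
  hg.integrable_mul' <| .add (hφ.integrable_mul' (hh.integrable_deriv.const_mul 2))
    (hh.integrable_mul hφ.integrable_deriv)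

theorem VanishesAtEnds.integral_pairing (hab : a < b) (hg : VanishesAtEnds a b g)
    (hh : HasIntegrableDeriv a b h) (hφ : HasIntegrableDeriv a b φ) :
    ∫ x, (2 * deriv h x * φ x + h x * deriv φ x) * g x ∂(intervalMeasure a b) =
      -∫ x, (h x * deriv g x - deriv h x * g x) * φ x ∂(intervalMeasure a b) := by
  have hghφ : VanishesAtEnds a b fun x => g x * (h x * φ x) := hg.mul hab (hh.mul hφ)
  have hint : Integrable (fun x => (h x * deriv g x - deriv h x * g x) * φ x)
      (intervalMeasure a b) := hφ.integrable_mul'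
    ((hh.integrable_mul hg.integrable_deriv).sub (hg.integrable_mul' hh.integrable_deriv))
  rw [← sub_eq_zero, sub_neg_eq_add, ← hghφ.integral_deriv_eq_zero hab,
    ← integral_add (hg.integrable_pairing hh hφ) hint]
  refine integral_congr_ae ?_
  filter_upwards [ae_mem_interval a b] with x hx
  rw [hg.deriv_mul (hh.mul hφ) hx, hh.deriv_mul hφ hx]
  ring

end Pairing

theorem rightFactor_mul_psi (p : Fin n → ℝ[X]) (f : ℝ → ℂ) (j l : Fin n) {x : ℝ} :
    rightFactor a b w p f j x * (psi w (p l) x : ℂ) =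
      -∑ k, (((momentMatrix a b w p)⁻¹ j k : ℝ) : ℂ) *
        ((2 * ((deriv (psi w (p k)) x : ℝ) : ℂ) * f x + (psi w (p k) x : ℂ) * deriv f x) *
          (psi w (p l) x : ℂ)) := by
  simp only [rightFactor, neg_mul, Finset.sum_mul, mul_assoc]

theorem integrable_pairing_psi (hψ : ∀ j, HasIntegrableDeriv a b (psi w (p j)))
    (hf : HasIntegrableDeriv a b f) (k l : Fin n) :
    Integrable (fun x => (2 * ((deriv (psi w (p k)) x : ℝ) : ℂ) * f x +
      (psi w (p k) x : ℂ) * deriv f x) * (psi w (p l) x : ℂ)) (intervalMeasure a b) := by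
  refine ((hψ l).ofReal.integrable_pairing (hψ k).ofReal hf).congr ?_
  filter_upwards [ae_mem_interval a b] with x hx
  rw [(hψ k).deriv_ofReal hx]

theorem integral_pairing_psi (hab : a < b) (hψ : ∀ j, VanishesAtEnds a b (psi w (p j)))
    (hf : HasIntegrableDeriv a b f) (k l : Fin n) :
    ∫ x, (2 * ((deriv (psi w (p k)) x : ℝ) : ℂ) * f x + (psi w (p k) x : ℂ) * deriv f x) *
      (psi w (p l) x : ℂ) ∂(intervalMeasure a b) = -weightedMomentMatrix a b w p f k l := by
  refine Eq.trans (integral_congr_ae ?_) <|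
    ((hψ l).ofReal.integral_pairing hab (hψ k).ofReal.toHasIntegrableDeriv hf).trans <|
    congrArg _ (integral_congr_ae ?_)
  · filter_upwards [ae_mem_interval a b] with x hx
    rw [(hψ k).deriv_ofReal hx]
  · filter_upwards [ae_mem_interval a b] with x hx
    rw [(hψ k).deriv_ofReal hx, (hψ l).deriv_ofReal hx, momentIntegrand]
    push_cast
    rfl

theorem integrable_rightFactor_mul_psi (hψ : ∀ j, HasIntegrableDeriv a b (psi w (p j)))
    (hf : HasIntegrableDeriv a b f) (j l : Fin n) :
    Integrable (fun x => rightFactor a b w p f j x * (psi w (p l) x : ℂ))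
      (intervalMeasure a b) := by
  simp only [rightFactor_mul_psi]
  exact (integrable_finsetSum _ fun k _ =>
    (integrable_pairing_psi hψ hf k l).const_mul _).neg

theorem integral_rightFactor_mul_psi (hab : a < b) (hψ : ∀ j, VanishesAtEnds a b (psi w (p j)))
    (hf : HasIntegrableDeriv a b f) :
    (of fun j l => ∫ x, rightFactor a b w p f j x * (psi w (p l) x : ℂ) ∂(intervalMeasure a b)) =
      (momentMatrix a b w p)⁻¹.map Complex.ofReal * weightedMomentMatrix a b w p f := by
  ext j l
  simp only [of_apply, rightFactor_mul_psi, mul_apply, map_apply, integral_neg]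
  rw [integral_finsetSum _ fun k _ => (integrable_pairing_psi
    (fun j => (hψ j).toHasIntegrableDeriv) hf k l).const_mul _, ← Finset.sum_neg_distrib]
  refine Finset.sum_congr rfl fun k _ => ?_
  rw [integral_const_mul, integral_pairing_psi hab hψ hf, mul_neg, neg_neg]

theorem hasFredholmDet_scalarKernel (hab : a < b) (hψ : ∀ j, VanishesAtEnds a b (psi w (p j)))
    (hf : HasIntegrableDeriv a b f) :
    HasFredholmDet a b (scalarKernel a b w p f)
      (1 + (momentMatrix a b w p)⁻¹.map Complex.ofReal * weightedMomentMatrix a b w p f).det := by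
  have hint := integrable_rightFactor_mul_psi (fun j => (hψ j).toHasIntegrableDeriv) hf
  have hminor : ∀ m : ℕ, kernelMinor (scalarKernel a b w p f) m
      =ᵐ[Measure.pi fun _ => intervalMeasure a b] fun x => (of fun i j : Fin m =>
        ∑ l, (psi w (p l) (x i) : ℂ) * rightFactor a b w p f l (x j)).det := by
    intro m
    filter_upwards [ae_pi_mem_interval a b m] with x hx
    rw [kernelMinor]
    congr with i j
    exact scalarKernel_eq_sum hψ f _ (hx j)
  refine ⟨fun m => (integrable_det_sum_mul hint m).congr (hminor m).symm, ?_⟩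
  rw [← integral_rightFactor_mul_psi hab hψ hf]
  simpa only [integral_congr_ae (hminor _)] using hasSum_fredholm_sum_mul hint

end Kernel

section MomentGen

variable {a b : EReal} {w : ℝ → ℝ} {N : ℕ} {p : Fin (2 * N) → ℝ[X]} {f : ℝ → ℂ}

theorem deformedDensity_zero (w : ℝ → ℝ) (N : ℕ) :
    deformedDensity w N 0 = fun x => (density w N x : ℂ) := by
  funext x
  simp [deformedDensity]

theorem integrable_density (hw_nonneg : ∀ x ∈ interval a b, 0 ≤ w x)
    (hw_diff : DifferentiableOn ℝ (fun x => √(w x)) (interval a b))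
    (hp : ∀ j, (p j).degree = ((j : ℕ) : WithBot ℕ))
    (hψ : ∀ j, HasIntegrableDeriv a b (psi w (p j))) :
    Integrable (density w N) (Measure.pi fun _ => intervalMeasure a b) := by
  have h := integrable_deformedDensity hw_nonneg hw_diff hp hψ (hasIntegrableDeriv_zero a b)
  rw [deformedDensity_zero] at h
  exact h.re

theorem det_map_ofReal {ι : Type*} [Fintype ι] [DecidableEq ι] (M : Matrix ι ι ℝ) :
    (M.map Complex.ofReal).det = M.det :=
  (Complex.ofRealHom.map_det M).symm

theorem partitionFunction_sq (hw_nonneg : ∀ x ∈ interval a b, 0 ≤ w x)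
    (hw_diff : DifferentiableOn ℝ (fun x => √(w x)) (interval a b))
    (hp : ∀ j, (p j).natDegree = j) (hψ : ∀ j, HasIntegrableDeriv a b (psi w (p j))) :
    (∏ j, (p j).leadingCoeff) ^ 2 * partitionFunction a b w N ^ 2 =
      N.factorial ^ 2 * (momentMatrix a b w p).det := by
  have h := integral_deformedDensity_sq hw_nonneg hw_diff hp hψ (hasIntegrableDeriv_zero a b)
  rw [weightedMomentMatrix_one_add hψ (hasIntegrableDeriv_zero a b), weightedMomentMatrix_zero,
    add_zero, deformedDensity_zero, integral_complex_ofReal, det_map_ofReal] at h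
  exact_mod_cast h

theorem isUnit_momentMatrix (hw_nonneg : ∀ x ∈ interval a b, 0 ≤ w x)
    (hw_diff : DifferentiableOn ℝ (fun x => √(w x)) (interval a b))
    (hp : ∀ j, (p j).degree = ((j : ℕ) : WithBot ℕ))
    (hψ : ∀ j, HasIntegrableDeriv a b (psi w (p j))) (hZ : partitionFunction a b w N ≠ 0) :
    IsUnit (momentMatrix a b w p) := by
  have hsq := partitionFunction_sq hw_nonneg hw_diff
    (fun j => natDegree_eq_of_degree_eq_some (hp j)) hψ
  have hne := mul_ne_zero (pow_ne_zero 2 (prod_leadingCoeff_ne_zero hp)) (pow_ne_zero 2 hZ)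
  rw [hsq] at hne
  exact (Matrix.isUnit_iff_isUnit_det _).2 (isUnit_iff_ne_zero.2 (right_ne_zero_of_mul hne))

theorem det_weightedMomentMatrix_one_add {n : ℕ} {p : Fin n → ℝ[X]}
    (hψ : ∀ j, HasIntegrableDeriv a b (psi w (p j))) (hM : IsUnit (momentMatrix a b w p))
    (hf : HasIntegrableDeriv a b f) :
    (weightedMomentMatrix a b w p fun x => 1 + f x).det = (momentMatrix a b w p).det *
      (1 + (momentMatrix a b w p)⁻¹.map Complex.ofReal * weightedMomentMatrix a b w p f).det := by
  have hinv : (momentMatrix a b w p).map Complex.ofReal *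
      (momentMatrix a b w p)⁻¹.map Complex.ofReal = 1 := by
    have h := congrArg Complex.ofRealHom.mapMatrix
      (Matrix.mul_nonsing_inv _ ((Matrix.isUnit_iff_isUnit_det _).1 hM))
    rwa [map_mul, map_one] at h
  rw [← det_map_ofReal, ← Matrix.det_mul, mul_add, mul_one, ← mul_assoc, hinv, one_mul,
    weightedMomentMatrix_one_add hψ hf]

theorem momentGen_sq (hw_nonneg : ∀ x ∈ interval a b, 0 ≤ w x)
    (hw_diff : DifferentiableOn ℝ (fun x => √(w x)) (interval a b))
    (hp : ∀ j, (p j).degree = ((j : ℕ) : WithBot ℕ))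
    (hψ : ∀ j, HasIntegrableDeriv a b (psi w (p j))) (hZ : partitionFunction a b w N ≠ 0)
    (hf : HasIntegrableDeriv a b f) :
    momentGen a b w N f ^ 2 = (1 + (momentMatrix a b w p)⁻¹.map Complex.ofReal *
      weightedMomentMatrix a b w p f).det := by
  have hdeg : ∀ j, (p j).natDegree = j := fun j => natDegree_eq_of_degree_eq_some (hp j)
  have hnum := integral_deformedDensity_sq hw_nonneg hw_diff hdeg hψ hf
  rw [det_weightedMomentMatrix_one_add hψ (isUnit_momentMatrix hw_nonneg hw_diff hp hψ hZ) hf,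
    ← mul_assoc] at hnum
  have hden := congrArg Complex.ofReal (partitionFunction_sq hw_nonneg hw_diff hdeg hψ)
  push_cast at hden hnum
  rw [← hden, mul_assoc] at hnum
  have hlead : (∏ j, ((p j).leadingCoeff : ℂ)) ^ 2 ≠ 0 :=
    pow_ne_zero 2 (by exact_mod_cast prod_leadingCoeff_ne_zero hp)
  rw [momentGen, div_pow, mul_left_cancel₀ hlead hnum,
    mul_div_cancel_left₀ _ (pow_ne_zero 2 (Complex.ofReal_ne_zero.2 hZ))]

end MomentGen

end SymplecticEnsemble

theorem mainTheorem5_general (a b : EReal) (w : ℝ → ℝ)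
    (hw_nonneg : ∀ x ∈ interval a b, 0 ≤ w x)
    (hw_pos : ∃ x ∈ interval a b, 0 < w x)
    (hw_diff : DifferentiableOn ℝ (fun x => √(w x)) (interval a b))
    (N : ℕ) (p : Fin (2 * N) → ℝ[X])
    (hp : ∀ j, (p j).degree = ((j : ℕ) : WithBot ℕ))
    (hψ : ∀ j, VanishesAtEnds a b (psi w (p j)))
    (f : ℝ → ℂ) (hf : HasIntegrableDeriv a b f) :
    Integrable (density w N) (Measure.pi fun _ => intervalMeasure a b) ∧
    0 < partitionFunction a b w N ∧
    Integrable (deformedDensity w N f) (Measure.pi fun _ => intervalMeasure a b) ∧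
    (∀ j k, Integrable (momentIntegrand w p j k) (intervalMeasure a b)) ∧
    IsUnit (momentMatrix a b w p) ∧
    (∀ x ∈ interval a b, ∀ y ∈ interval a b,
      Integrable (fun t => kernel22 a b w p x t * epsKernel t y) (intervalMeasure a b)) ∧
    HasFredholmDet a b (scalarKernel a b w p f) (momentGen a b w N f ^ 2) := by
  have hab : a < b := hw_pos.elim fun _ hx => hx.1.1.trans hx.1.2
  have hψ' : ∀ j, HasIntegrableDeriv a b (psi w (p j)) := fun j => (hψ j).toHasIntegrableDeriv
  have hw_cont : ContinuousOn w (interval a b) :=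
    (hw_diff.continuousOn.pow 2).congr fun x hx => (Real.sq_sqrt (hw_nonneg x hx)).symm
  have hint := integrable_density hw_nonneg hw_diff hp hψ'
  have hZ := partitionFunction_pos hw_nonneg hw_pos hw_cont hint
  refine ⟨hint, hZ, integrable_deformedDensity hw_nonneg hw_diff hp hψ' hf,
    integrable_momentIntegrand hψ', isUnit_momentMatrix hw_nonneg hw_diff hp hψ' hZ.ne',
    fun x _ y _ => integrable_kernel22_mul_epsKernel hψ' x y, ?_⟩
  rw [momentGen_sq hw_nonneg hw_diff hp hψ' hZ.ne' hf]
  exact hasFredholmDet_scalarKernel hab hψ hf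

/-- `w` is a weight on the interval with endpoints `a`, `b` (finite or infinite), with all moments,
with `√w` differentiable inside and with `w(a) = w(b) = 0` (as limits); `π_j`, `j < 2N`, are
arbitrary polynomials of degree `j`, and the `(π_j √w)'` are integrable. The first conjuncts say
that the normalization, `G_N^{(4)}(f)`, the matrix `M^{(4)}`, its inverse and the kernel of `K ε`
are well defined; the last one is the determinant formula. -/
theorem mainTheorem5 (a b : EReal) (w : ℝ → ℝ)
    (hw_nonneg : ∀ x ∈ interval a b, 0 ≤ w x)
    (hw_pos : ∃ x ∈ interval a b, 0 < w x)
    (hw_moments : ∀ j : ℕ, Integrable (fun x => x ^ j * w x) (intervalMeasure a b))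
    (hw_diff : DifferentiableOn ℝ (fun x => √(w x)) (interval a b))
    (hw_left : Tendsto w (comap ((↑) : ℝ → EReal) (𝓝[>] a)) (𝓝 0))
    (hw_right : Tendsto w (comap ((↑) : ℝ → EReal) (𝓝[<] b)) (𝓝 0))
    (N : ℕ) (p : Fin (2 * N) → ℝ[X])
    (hp : ∀ j, (p j).degree = ((j : ℕ) : WithBot ℕ))
    (hp_int : ∀ j, Integrable (deriv (psi w (p j))) (intervalMeasure a b))
    (f : 𝓢(ℝ, ℂ)) :
    Integrable (density w N) (Measure.pi fun _ => intervalMeasure a b) ∧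
    0 < partitionFunction a b w N ∧
    Integrable (deformedDensity w N f) (Measure.pi fun _ => intervalMeasure a b) ∧
    (∀ j k, Integrable (momentIntegrand w p j k) (intervalMeasure a b)) ∧
    IsUnit (momentMatrix a b w p) ∧
    (∀ x ∈ interval a b, ∀ y ∈ interval a b,
      Integrable (fun t => kernel22 a b w p x t * epsKernel t y) (intervalMeasure a b)) ∧
    HasFredholmDet a b (scalarKernel a b w p f) (momentGen a b w N f ^ 2) := by
  have hab : a < b := hw_pos.elim fun _ hx => hx.1.1.trans hx.1.2
  exact mainTheorem5_general a b w hw_nonneg hw_pos hw_diff N p hp (fun j =>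
    vanishesAtEnds_psi hab hw_nonneg hw_moments hw_diff hw_left hw_right (hp_int j)) f
    (hasIntegrableDeriv_schwartzMap a b f)
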